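/- Let $a<b$ be integers, $N\ge 0$ an integer, $\beta>0$, $\mathbf I=\{a,a+1,\dots,b\}$, $\mathbf I^*=\{a+\tfrac12,\dots,b-\tfrac12\}$, $\mathbf J=\{0,1,\dots,N\}$, and let $\mathcal S$ be the complex vector space with basis $(\mathbf e_\sigma)$, $\sigma\in\{\pm1\}^{\mathbf I}$. Let $V=(V^{\mathrm h})^{1/2}V^{\mathrm v}(V^{\mathrm h})^{1/2}$ be the Ising transfer matrix on $\mathcal S$, where $(V^{\mathrm h})^{1/2}$ is diagonal with entries $\exp\big(\tfrac\beta2\sum_{i=a}^{b-1}\sigma_i\sigma_{i+1}\big)$, and $V^{\mathrm v}_{\sigma\rho}=\exp\big(\beta\sum_{i=a}^{b}\sigma_i\rho_i\big)$ if $\sigma_a=\rho_a$ and $\sigma_b=\rho_b$, and $V^{\mathrm v}_{\sigma\rho}=0$ otherwise. For $k\in\mathbf I^*$ define operators on $\mathcal S$ by $$p_k\mathbf e_\sigma=\sigma_{k+\frac12}\mathbf e_\tau,\qquad q_k\mathbf e_\sigma=\mathrm i\,\sigma_{k-\frac12}\mathbf e_\tau,\qquad \tau_x=\begin{cases}\sigma_x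 & x>k\\ -\sigma_x & x<k,\end{cases}$$ and $\psi_k=\tfrac{\mathrm i}{\sqrt2}(p_k+q_k)$, $\bar\psi_k=\tfrac1{\sqrt2}(p_k-q_k)$. The fermion operators on the horizontal edges $k+\mathrm iy$ ($k\in\mathbf I^*$, $y\in\mathbf J$) of the box $\mathbf I\times\mathbf J$ are $\psi(k+\mathrm iy)=V^{-y}\psi_kV^y$ and $\bar\psi(k+\mathrm iy)=V^{-y}\bar\psi_kV^y$. Put $\lambda=e^{\mathrm i\pi/4}$, $\alpha=e^{-2\beta}$, $\nu=\bar\lambda^{3}\,\frac{\alpha+\mathrm i}{\alpha-\mathrm i}$. On the vertical edges $x+\mathrm i(y+\tfrac12)$ ($x\in\mathbf I$, $0\le y<N$) the operators $\psi,\bar\psi$ are the solution, in terms of the row $y$ below, of the relations $$\psi(S)+\nu\lambda^{3}\bar\psi(S)=\nu\,\psi(E)+\lambda^{3}\bar\psi(E),\qquad \psi(S)+\nu^{-1}\lambda^{-3}\bar\psi(S)=\nu^{-1}\psi(W)+\lambda^{-3}\bar\psi(W)$$ for each face with south, east and west edges $S,E,W$, together with $\psi+\mathrm i\bar\psi=0$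 on the vertical edges with $x=a$ and $\psi-\mathrm i\bar\psi=0$ on those with $x=b$; these determine $\psi,\bar\psi$ on all vertical edges (this is the massive s-holomorphic extension of $\psi,\bar\psi$). For edges $z_1,\dots,z_n$ ($n\ge0$) and $\psi^{(1)},\dots,\psi^{(n)}$, each of which is $\psi$ or $\bar\psi$, put $$\big\langle\psi^{(1)}(z_1)\cdots\psi^{(n)}(z_n)\big\rangle=\frac{\mathbf e_{(+)}^{\top}V^N\psi^{(1)}(z_1)\cdots\psi^{(n)}(z_n)\,\mathbf e_{(+)}}{\mathbf e_{(+)}^{\top}V^N\mathbf e_{(+)}},$$ where $(+)$ is the constant configuration $+1$. Let $\mathrm{Pf}(A)=\frac1{2^m m!}\sum_{\pi\in S_{2m}}\mathrm{sgn}(\pi)\prod_{s=1}^mA_{\pi(2s-1),\pi(2s)}$ for a matrix $A$ of size $n=2m$, and $\mathrm{Pf}(A)=0$ if $n$ is odd. **Theorem.** Let $C_{ij}=\langle\psi^{(i)}(z_i)\psi^{(j)}(z_j)\rangle$ for $1\le i,j\le n$, and let $A$ be the antisymmetric matrix with $A_{ij}=C_{ij}$ for $i<j$ (so $A_{ij}=-C_{ji}$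 for $i>j$, and $A_{ii}=0$). Then $$\big\langle\psi^{(1)}(z_1)\cdots\psi^{(n)}(z_n)\big\rangle=\mathrm{Pf}(A).$$ In particular, if $C_{ij}=-C_{ji}$ for all $i\ne j$, then $\big\langle\psi^{(1)}(z_1)\cdots\psi^{(n)}(z_n)\big\rangle=\mathrm{Pf}(C)$. -/

import Mathlib

noncomputable section

namespace IsingFermion

/-- The row `I = {a, a + 1, …, b}` of sites. -/
abbrev Site (a b : ℤ) : Type := {x : ℤ // x ∈ Set.Icc a b}

/-- The dual row `I* = {a + 1/2, …, b - 1/2}`; the half-integer `k` is encoded by the integer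
`k - 1/2`, which runs through `a, …, b - 1`. -/
abbrev DualSite (a b : ℤ) : Type := {x : ℤ // x ∈ Set.Ico a b}

/-- The site `k - 1/2`. -/
def DualSite.left {a b : ℤ} (k : DualSite a b) : Site a b :=
  ⟨k.1, k.2.1, k.2.2.le⟩

/-- The site `k + 1/2`. -/
def DualSite.right {a b : ℤ} (k : DualSite a b) : Site a b :=
  ⟨k.1 + 1, by have := k.2.1; lia, by have := k.2.2; lia⟩

/-- Spin configurations `σ ∈ {±1}^I` in a row. -/
abbrev Config (a b : ℤ) : Type := Site a b → ℤˣ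

/-- Linear operators on the state space, which has the basis `(e_σ)`, as complex matrices:
column `σ` of the matrix is the image of `e_σ`. -/
abbrev Op (a b : ℤ) : Type := Matrix (Config a b) (Config a b) ℂ

/-- The value `±1` of a spin as a real number. -/
def spin (u : ℤˣ) : ℝ := ((u : ℤ) : ℝ)

/-- The diagonal matrix `(V^h)^{1/2}` of half of the horizontal interactions in a row. -/
def transferHSqrt (a b : ℤ) (β : ℝ) : Op a b :=
  Matrix.diagonal fun σ =>
    ((Real.exp (β / 2 * ∑ k : DualSite a b, spin (σ k.left) * spin (σ k.right)) : ℝ) : ℂ)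

/-- The matrix `V^v` of the vertical interactions between two rows, with the spins at both
extremities of the row kept fixed. -/
def transferV (a b : ℤ) (β : ℝ) : Op a b := by
  classical
  exact Matrix.of fun σ ρ =>
    if ∀ i : Site a b, (i.1 = a ∨ i.1 = b) → σ i = ρ i then
      ((Real.exp (β * ∑ i : Site a b, spin (σ i) * spin (ρ i)) : ℝ) : ℂ)
    else 0

/-- The transfer matrix `V = (V^h)^{1/2} V^v (V^h)^{1/2}`. -/
def transfer (a b : ℤ) (β : ℝ) : Op a b :=
  transferHSqrt a b β * transferV a b β * transferHSqrt a b β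

/-- The configuration obtained from `σ` by flipping all spins to the left of `k`. -/
def flipLeft {a b : ℤ} (k : DualSite a b) (σ : Config a b) : Config a b :=
  fun x => if x.1 ≤ k.1 then -σ x else σ x

/-- The Clifford generator `p_k`: `p_k e_σ = σ_{k+1/2} e_τ`, with `τ = flipLeft k σ`. -/
def opP {a b : ℤ} (k : DualSite a b) : Op a b :=
  Matrix.of fun τ σ => if τ = flipLeft k σ then (spin (σ k.right) : ℂ) else 0

/-- The Clifford generator `q_k`: `q_k e_σ = i σ_{k-1/2} e_τ`, with `τ = flipLeft k σ`. -/
def opQ {a b : ℤ} (k : DualSite a b) : Op a b :=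
  Matrix.of fun τ σ => if τ = flipLeft k σ then Complex.I * (spin (σ k.left) : ℂ) else 0

/-- The two species of fermions: `ψ` (holomorphic) and `ψ̄` (antiholomorphic). -/
inductive Species : Type
  | psi
  | psiBar

/-- `ψ_k = (i/√2)(p_k + q_k)` and `ψ̄_k = (1/√2)(p_k - q_k)`. -/
def baseFermion {a b : ℤ} (k : DualSite a b) : Species → Op a b
  | .psi => (Complex.I / (Real.sqrt 2 : ℂ)) • (opP k + opQ k)
  | .psiBar => (1 / (Real.sqrt 2 : ℂ)) • (opP k - opQ k)

/-- The edges of the box `I × J`, `J = {0, …, N}`: the horizontal edges with midpoints `k + i y`,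
`k ∈ I*`, `y ∈ J`, and the vertical edges with midpoints `x + i (y + 1/2)`, `x ∈ I`,
`0 ≤ y < N`. -/
inductive Edge (a b : ℤ) (N : ℕ) : Type
  | horizontal (k : DualSite a b) (y : Fin (N + 1))
  | vertical (x : Site a b) (y : Fin N)

/-- `λ = e^{iπ/4}`. -/
def lam : ℂ := Complex.exp (Complex.I * Real.pi / 4)

/-- `ν = λ̄³ (α + i) / (α - i)` with `α = e^{-2β}`. -/
def nu (β : ℝ) : ℂ :=
  (starRingEnd ℂ lam) ^ 3 * (((Real.exp (-2 * β) : ℝ) : ℂ) + Complex.I) /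
    (((Real.exp (-2 * β) : ℝ) : ℂ) - Complex.I)

/-- The fermion operators on horizontal edges: `ψ(k + i y) = V^{-y} ψ_k V^y`, and likewise for
`ψ̄`. -/
def fermionHorizontal {a b : ℤ} (β : ℝ) (k : DualSite a b) (y : ℕ) (s : Species) : Op a b :=
  (transfer a b β)⁻¹ ^ y * baseFermion k s * transfer a b β ^ y

/-- The combination `ψ(S) + ν λ³ ψ̄(S)`, `S = k + i y`, which has to be equal to
`ν ψ(E) + λ³ ψ̄(E)` on the east edge `E` of the face above `S`. -/
def southEast {a b : ℤ} (β : ℝ) (k : DualSite a b) (y : ℕ) : Op a b :=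
  fermionHorizontal β k y .psi + (nu β * lam ^ 3) • fermionHorizontal β k y .psiBar

/-- The combination `ψ(S) + ν⁻¹ λ⁻³ ψ̄(S)`, `S = k + i y`, which has to be equal to
`ν⁻¹ ψ(W) + λ⁻³ ψ̄(W)` on the west edge `W` of the face above `S`. -/
def southWest {a b : ℤ} (β : ℝ) (k : DualSite a b) (y : ℕ) : Op a b :=
  fermionHorizontal β k y .psi + ((nu β)⁻¹ * lam⁻¹ ^ 3) • fermionHorizontal β k y .psiBar

/-- The fermion operators on the vertical edge with midpoint `x + i (y + 1/2)`, obtained by solving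
for them, in terms of the row `y` below, the two linear relations of the faces to the left and to
the right of the edge; on the left (right) boundary of the box the missing relation is replaced
by the boundary condition `ψ + i ψ̄ = 0` (`ψ - i ψ̄ = 0`). -/
def fermionVertical {a b : ℤ} (β : ℝ) (x : Site a b) (y : ℕ) (s : Species) : Op a b :=
  if hl : a < x.1 then
    if hr : x.1 < b then
      let u := southEast β (⟨x.1 - 1, by lia, by lia⟩ : DualSite a b) y
      let v := southWest β (⟨x.1, hl.le, hr⟩ : DualSite a b) y
      let d := nu β * lam⁻¹ ^ 3 - (nu β)⁻¹ * lam ^ 3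
      match s with
      | .psi => d⁻¹ • (lam⁻¹ ^ 3 • u - lam ^ 3 • v)
      | .psiBar => d⁻¹ • (nu β • v - (nu β)⁻¹ • u)
    else
      let u := southEast β (⟨x.1 - 1, by lia, by have := x.2.2; lia⟩ : DualSite a b) y
      let w := (lam ^ 3 + Complex.I * nu β)⁻¹ • u
      match s with
      | .psi => Complex.I • w
      | .psiBar => w
  else
    if hr : x.1 < b then
      let v := southWest β (⟨x.1, x.2.1, hr⟩ : DualSite a b) y
      let w := (lam⁻¹ ^ 3 - Complex.I * (nu β)⁻¹)⁻¹ • v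
      match s with
      | .psi => -(Complex.I • w)
      | .psiBar => w
    else 0

/-- The fermion operators `ψ(z)` and `ψ̄(z)` on the edges of the box. -/
def fermion {a b : ℤ} {N : ℕ} (β : ℝ) : Edge a b N → Species → Op a b
  | .horizontal k y, s => fermionHorizontal β k y s
  | .vertical x y, s => fermionVertical β x y s

/-- The defining properties of the fermion operators: `ψ(k + i y) = V^{-y} ψ_k V^y` (and likewise
for `ψ̄`) on horizontal edges, the (massive) s-holomorphicity relations on the four edges
`N, E, S, W` of every face, and the boundary relations on the left and right boundaries. -/
structure IsFermionField {a b : ℤ} {N : ℕ} (β : ℝ) (F : Edge a b N → Species → Op a b) : Prop where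
  horizontal : ∀ k y s, F (.horizontal k y) s =
    (transfer a b β)⁻¹ ^ (y : ℕ) * baseFermion k s * transfer a b β ^ (y : ℕ)
  northEast : ∀ (k : DualSite a b) (y : Fin N),
    F (.horizontal k y.succ) .psi + ((nu β)⁻¹ * lam) • F (.horizontal k y.succ) .psiBar =
      (nu β)⁻¹ • F (.vertical k.right y) .psi + lam • F (.vertical k.right y) .psiBar
  northWest : ∀ (k : DualSite a b) (y : Fin N),
    F (.horizontal k y.succ) .psi + (nu β * lam⁻¹) • F (.horizontal k y.succ) .psiBar =
      nu β • F (.vertical k.left y) .psi + lam⁻¹ • F (.vertical k.left y) .psiBar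
  southEast : ∀ (k : DualSite a b) (y : Fin N),
    F (.horizontal k y.castSucc) .psi + (nu β * lam ^ 3) • F (.horizontal k y.castSucc) .psiBar =
      nu β • F (.vertical k.right y) .psi + lam ^ 3 • F (.vertical k.right y) .psiBar
  southWest : ∀ (k : DualSite a b) (y : Fin N),
    F (.horizontal k y.castSucc) .psi +
        ((nu β)⁻¹ * lam⁻¹ ^ 3) • F (.horizontal k y.castSucc) .psiBar =
      (nu β)⁻¹ • F (.vertical k.left y) .psi + lam⁻¹ ^ 3 • F (.vertical k.left y) .psiBar
  boundaryLeft : ∀ (x : Site a b) (y : Fin N), x.1 = a →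
    F (.vertical x y) .psi + Complex.I • F (.vertical x y) .psiBar = 0
  boundaryRight : ∀ (x : Site a b) (y : Fin N), x.1 = b →
    F (.vertical x y) .psi - Complex.I • F (.vertical x y) .psiBar = 0

theorem lam_ne_zero : lam ≠ 0 := Complex.exp_ne_zero _

theorem lam_sq : lam ^ 2 = Complex.I := by
  rw [lam, ← Complex.exp_nat_mul]
  refine Eq.trans ?_ Complex.exp_pi_div_two_mul_I
  congr 1
  push_cast
  ring

theorem conj_lam : (starRingEnd ℂ) lam = lam⁻¹ := by
  rw [lam, ← Complex.exp_conj, ← Complex.exp_neg]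
  congr 1
  simp [Complex.conj_ofNat]
  ring

theorem sub_I_ne_zero (r : ℝ) : (r : ℂ) - Complex.I ≠ 0 := by
  intro h
  have := congrArg Complex.im h
  simp at this

theorem add_I_ne_zero (r : ℝ) : (r : ℂ) + Complex.I ≠ 0 := by
  intro h
  have := congrArg Complex.im h
  simp at this

theorem nu_eq (β : ℝ) : nu β * lam ^ 3 * (((Real.exp (-2 * β) : ℝ) : ℂ) - Complex.I) =
    ((Real.exp (-2 * β) : ℝ) : ℂ) + Complex.I := by
  have h1 := sub_I_ne_zero (Real.exp (-2 * β))
  have h2 := lam_ne_zero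
  rw [nu, conj_lam]
  generalize ((Real.exp (-2 * β) : ℝ) : ℂ) = r at h1 ⊢
  have h3 : lam⁻¹ ^ 3 * lam ^ 3 = 1 := by rw [← mul_pow, inv_mul_cancel₀ h2, one_pow]
  calc lam⁻¹ ^ 3 * (r + Complex.I) / (r - Complex.I) * lam ^ 3 * (r - Complex.I)
      = (lam⁻¹ ^ 3 * lam ^ 3) * (r + Complex.I) * ((r - Complex.I) / (r - Complex.I)) := by ring
    _ = r + Complex.I := by rw [h3, div_self h1, one_mul, mul_one]

theorem nu_ne_zero (β : ℝ) : nu β ≠ 0 := by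
  intro h
  have := nu_eq β
  rw [h] at this
  exact add_I_ne_zero (Real.exp (-2 * β)) (by simpa using this.symm)

theorem nu_ne (β : ℝ) : nu β ≠ Complex.I * lam ^ 3 := by
  intro h
  have h1 := nu_eq β
  have h6 : lam ^ 6 = -Complex.I := by
    have : lam ^ 6 = (lam ^ 2) ^ 3 := by ring
    rw [this, lam_sq, pow_succ, Complex.I_sq]; ring
  have h2 : Complex.I * lam ^ 3 * lam ^ 3 = 1 := by
    have : Complex.I * lam ^ 3 * lam ^ 3 = Complex.I * lam ^ 6 := by ring
    rw [this, h6, mul_neg, Complex.I_mul_I, neg_neg]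
  rw [h, h2] at h1
  have h3 : Complex.I = 0 := by linear_combination (-1 / 2) * h1
  exact Complex.I_ne_zero h3

theorem nu_sq_ne {β : ℝ} (hβ : 0 < β) : nu β ^ 2 ≠ lam ^ 6 := by
  intro h
  have h1 := congrArg (· ^ 2) (nu_eq β)
  have h12 : nu β ^ 2 * lam ^ 6 = -1 := by
    rw [h]
    have : lam ^ 6 * lam ^ 6 = ((lam ^ 2) ^ 2) ^ 3 := by ring
    rw [this, lam_sq, Complex.I_sq]; norm_num
  have h3 : ((Real.exp (-2 * β) : ℝ) : ℂ) ^ 2 = 1 := by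
    set α : ℂ := ((Real.exp (-2 * β) : ℝ) : ℂ)
    have h4 : nu β ^ 2 * lam ^ 6 * (α - Complex.I) ^ 2 = (α + Complex.I) ^ 2 := by
      linear_combination h1
    rw [h12] at h4
    have hI := Complex.I_sq
    linear_combination (-1 / 2) * h4 - hI
  have h5 : Real.exp (-2 * β) ^ 2 = 1 := by exact_mod_cast h3
  have h6 : Real.exp (-2 * β) < 1 := Real.exp_lt_one_iff.mpr (by linarith)
  have h7 := Real.exp_pos (-2 * β)
  nlinarith

/-- The operators on the vertical edges are determined by the defining properties: the operators
`fermion β` are the only ones that can have them. -/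
theorem IsFermionField.eq_fermion {a b : ℤ} (hab : a < b) {N : ℕ} {β : ℝ} (hβ : 0 < β)
    {F : Edge a b N → Species → Op a b} (hF : IsFermionField β F) : F = fermion β := by
  have hl0 := lam_ne_zero
  have hn0 := nu_ne_zero β
  have hn1 := nu_ne β
  have hn2 := nu_sq_ne hβ
  have hH : ∀ k y s, F (.horizontal k y) s = fermionHorizontal β k y s := hF.horizontal
  have hSE : ∀ (k : DualSite a b) (y : Fin N), IsingFermion.southEast β k y =
      nu β • F (.vertical k.right y) .psi + lam ^ 3 • F (.vertical k.right y) .psiBar := by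
    intro k y
    rw [← hF.southEast k y, hH, hH]; rfl
  have hSW : ∀ (k : DualSite a b) (y : Fin N), IsingFermion.southWest β k y =
      (nu β)⁻¹ • F (.vertical k.left y) .psi + lam⁻¹ ^ 3 • F (.vertical k.left y) .psiBar := by
    intro k y
    rw [← hF.southWest k y, hH, hH]; rfl
  have hd : nu β * lam⁻¹ ^ 3 - (nu β)⁻¹ * lam ^ 3 ≠ 0 := by
    intro h
    apply hn2
    field_simp at h
    linear_combination h
  have hr' : lam ^ 3 + Complex.I * nu β ≠ 0 := by
    intro h
    apply hn1
    linear_combination (-Complex.I) * h + nu β * Complex.I_sq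
  have hl' : lam⁻¹ ^ 3 - Complex.I * (nu β)⁻¹ ≠ 0 := by
    intro h
    apply hn1
    field_simp at h
    linear_combination h
  funext e s
  cases e with
  | horizontal k y => exact hH k y s
  | vertical x y =>
    simp only [fermion]
    unfold fermionVertical
    by_cases hl : a < x.1
    · have hx1 : DualSite.right (⟨x.1 - 1, by lia, by have := x.2.2; lia⟩ : DualSite a b) = x :=
        Subtype.ext (by simp [DualSite.right])
      have e1 := hSE ⟨x.1 - 1, by lia, by have := x.2.2; lia⟩ y
      rw [hx1] at e1
      by_cases hr : x.1 < b
      · have e2 := hSW ⟨x.1, hl.le, hr⟩ y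
        have hx2 : DualSite.left (⟨x.1, hl.le, hr⟩ : DualSite a b) = x := rfl
        rw [hx2] at e2
        simp only [dif_pos hl, dif_pos hr]
        cases s <;> simp only [e1, e2] <;> rw [eq_inv_smul_iff₀ hd]
        · match_scalars <;> field_simp
          ring
        · match_scalars <;> field_simp
          ring
      · have e3 := hF.boundaryRight x y (le_antisymm x.2.2 (not_lt.mp hr))
        rw [sub_eq_zero] at e3
        have e4 : F (.vertical x y) .psiBar = (lam ^ 3 + Complex.I * nu β)⁻¹ •
            IsingFermion.southEast β ⟨x.1 - 1, by lia, by have := x.2.2; lia⟩ y := by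
          rw [eq_inv_smul_iff₀ hr', e1, e3]
          match_scalars; ring
        simp only [dif_pos hl, dif_neg hr]
        cases s
        · simp only; rw [← e4, e3]
        · simp only; rw [← e4]
    · have hxa : x.1 = a := le_antisymm (not_lt.mp hl) x.2.1
      have hr : x.1 < b := by lia
      have e2 := hSW ⟨x.1, x.2.1, hr⟩ y
      have hx2 : DualSite.left (⟨x.1, x.2.1, hr⟩ : DualSite a b) = x := rfl
      rw [hx2] at e2
      have e3 := hF.boundaryLeft x y hxa
      rw [add_eq_zero_iff_eq_neg] at e3
      have e4 : F (.vertical x y) .psiBar = (lam⁻¹ ^ 3 - Complex.I * (nu β)⁻¹)⁻¹ •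
          IsingFermion.southWest β ⟨x.1, x.2.1, hr⟩ y := by
        rw [eq_inv_smul_iff₀ hl', e2, e3]
        match_scalars; ring
      simp only [dif_neg hl, dif_pos hr]
      cases s
      · simp only; rw [← e4, e3]
      · simp only; rw [← e4]

/-- The basis vector `e_{(+)}` of the constant configuration `+1`. -/
def plusVec (a b : ℤ) : Config a b → ℂ := Pi.single (fun _ => 1) 1

/-- The correlation `⟨e₊| V^N O₁ ⋯ O_r |e₊⟩ / ⟨e₊| V^N |e₊⟩` of a list `O₁, …, O_r` of operators
in the box with rows `0, …, N`. -/
def correlation {a b : ℤ} (N : ℕ) (β : ℝ) (L : List (Op a b)) : ℂ :=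
  (plusVec a b ⬝ᵥ ((transfer a b β ^ N * L.prod).mulVec (plusVec a b))) /
    (plusVec a b ⬝ᵥ ((transfer a b β ^ N).mulVec (plusVec a b)))

/-- The Pfaffian: `0` for odd `n`, and for `n = 2m`
`(1 / (2^m m!)) ∑_π sgn(π) ∏_{s=1}^m A_{π(2s-1), π(2s)}`. -/
def pfaffian {n : ℕ} (A : Matrix (Fin n) (Fin n) ℂ) : ℂ :=
  if Even n then
    1 / ((2 : ℂ) ^ (n / 2) * (Nat.factorial (n / 2) : ℂ)) *
      ∑ π : Equiv.Perm (Fin n), ((Equiv.Perm.sign π : ℤ) : ℂ) *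
        ∏ s : Fin (n / 2), A (π ⟨2 * s.1, by lia⟩) (π ⟨2 * s.1 + 1, by lia⟩)
  else 0

/-- The antisymmetric matrix with the same entries above the diagonal as `A`. -/
def skewOfUpper {n : ℕ} (A : Matrix (Fin n) (Fin n) ℂ) : Matrix (Fin n) (Fin n) ℂ :=
  Matrix.of fun i j => if i < j then A i j else if j < i then -A j i else 0

/-- The multipoint correlation `⟨ψ⁽¹⁾(z₁) ⋯ ψ⁽ⁿ⁾(zₙ)⟩`, each `ψ⁽ⁱ⁾` being `ψ` or `ψ̄`. -/
def multiPoint {a b : ℤ} {N n : ℕ} (β : ℝ) (s : Fin n → Species) (z : Fin n → Edge a b N) : ℂ :=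
  correlation N β (List.ofFn fun i => fermion β (z i) (s i))

/-- The matrix of two-point correlations `⟨ψ⁽ⁱ⁾(z_i) ψ⁽ʲ⁾(z_j)⟩`. -/
def twoPointMatrix {a b : ℤ} {N n : ℕ} (β : ℝ) (s : Fin n → Species) (z : Fin n → Edge a b N) :
    Matrix (Fin n) (Fin n) ℂ :=
  Matrix.of fun i j => correlation N β [fermion β (z i) (s i), fermion β (z j) (s j)]

end IsingFermion

end

/-! The theorem is Wick's theorem for a Clifford algebra. The operators `p_k`, `q_k` span a space
`W` (`cliffordSpace`) in which every anticommutator is a scalar.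

Conjugation by the transfer matrix preserves `W`: `V` is, up to a nonzero scalar, a product of
factors `s + tX` with `X` quadratic in the generators, `X² = 1` and `s² ≠ t²`
(`intertwines_smul_one_add_smul`). The bonds `σ_{k-1/2} σ_{k+1/2}` and the flips of single interior
spins are such `X`; the fixed boundary spins keep all other flips out of `V`. Hence the fermions on
horizontal edges lie in `W`, and so do those on vertical edges, being linear combinations of them
(`fermion_mem`).

The normalised functional `ω(X) = ⟨e₊|V^N X|e₊⟩ / ⟨e₊|V^N|e₊⟩` is a vacuum for `W`. The elements
`q_k - i p_k` kill `e₊` from the right, and the conjugates by `V^N` of `q_k + i p_k` are killed by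
`e₊ᵀ V^N` from the left. These two families are jointly independent
(`linearIndependent_annihilator`), so by counting dimensions they span `W`.

Splitting the first factor of a product as `l + r`, the part `l` vanishes at once and `r` is
anticommuted to the far end, where it vanishes too (`IsVacuum.map_mul_prod`). The resulting
recursion is the expansion of a Pfaffian along its first row (`pfaffian_succ_succ`). -/

noncomputable section

namespace IsingFermion

/-! ### Pfaffians: expansion along the first row -/

/-- The signed term of the permutation `π` in the Pfaffian of a matrix of size `2 m`. -/
def pfaffianTerm {n : ℕ} (m : ℕ) (h : n = 2 * m) (A : Matrix (Fin n) (Fin n) ℂ)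
    (π : Equiv.Perm (Fin n)) : ℂ :=
  ((Equiv.Perm.sign π : ℤ) : ℂ) *
    ∏ s : Fin m, A (π ⟨2 * s.1, by lia⟩) (π ⟨2 * s.1 + 1, by lia⟩)

theorem pfaffian_eq_sum_pfaffianTerm {n : ℕ} (m : ℕ) (h : n = 2 * m)
    (A : Matrix (Fin n) (Fin n) ℂ) :
    pfaffian A = 1 / ((2 : ℂ) ^ m * (Nat.factorial m : ℂ)) * ∑ π, pfaffianTerm m h A π := by
  subst h
  have hm : 2 * m / 2 = m := by lia
  unfold pfaffian pfaffianTerm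
  rw [if_pos (even_two_mul m)]
  refine congrArg₂ (· * ·) (by simp only [hm]) (Finset.sum_congr rfl fun π _ => ?_)
  exact congrArg (_ * ·) (Fintype.prod_equiv (finCongr hm) _ _ fun s => rfl)

theorem sum_perm_fix_zero {M : Type*} [AddCommMonoid M] {n : ℕ}
    (f : Equiv.Perm (Fin (n + 1)) → M) :
    ∑ π with π 0 = 0, f π = ∑ e, f (Equiv.Perm.decomposeFin.symm (0, e)) := by
  rw [Finset.sum_filter, ← Equiv.Perm.decomposeFin.symm.sum_comp, Fintype.sum_prod_type,
    Fin.sum_univ_succ]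
  simp [Fin.succ_ne_zero]

/-- The inverse of `Fin.cycleRange j` sends `0` to `j` and `i.succ` to `j.succAbove i`, and has sign
`(-1)^j`. Using it as the representative of the coset `π 0 = j` produces the minors and signs of the
expansion with no further reordering. -/
theorem sum_perm_eq_sum_cycleRange {M : Type*} [AddCommMonoid M] {n : ℕ}
    (f : Equiv.Perm (Fin (n + 1)) → M) :
    ∑ π, f π = ∑ j : Fin (n + 1), ∑ e,
      f ((Fin.cycleRange j)⁻¹ * Equiv.Perm.decomposeFin.symm (0, e)) := by
  rw [← Finset.sum_fiberwise Finset.univ (fun π : Equiv.Perm (Fin (n + 1)) => π 0)]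
  refine Finset.sum_congr rfl fun j _ => ?_
  rw [← sum_perm_fix_zero fun e => f ((Fin.cycleRange j)⁻¹ * e), Finset.sum_filter,
    Finset.sum_filter]
  refine (Fintype.sum_equiv (Equiv.mulLeft (Fin.cycleRange j)⁻¹) _ _ fun e => ?_).symm
  have : ((Fin.cycleRange j)⁻¹ * e) 0 = j ↔ e 0 = 0 := by
    rw [Equiv.Perm.mul_apply, Equiv.Perm.inv_eq_iff_eq, Fin.cycleRange_self]
  simp only [Equiv.coe_mulLeft, this]

theorem sum_pfaffianTerm_fiber_eq {n m : ℕ} (h : n = 2 * m) (A : Matrix (Fin n) (Fin n) ℂ)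
    (ρ : Equiv.Perm (Fin n)) (hρ : ∀ π, pfaffianTerm m h A (π * ρ) = pfaffianTerm m h A π)
    (x : Fin n) {p q : Fin n} (hpq : ρ p = q) :
    ∑ π with π q = x, pfaffianTerm m h A π = ∑ π with π p = x, pfaffianTerm m h A π := by
  rw [Finset.sum_filter, Finset.sum_filter]
  refine Fintype.sum_equiv (Equiv.mulRight ρ) _ _ fun π => ?_
  simp only [Equiv.coe_mulRight, Equiv.Perm.mul_apply, hpq, hρ]

theorem pfaffianTerm_mul_swap_pair {n m : ℕ} (h : n = 2 * m) (A : Matrix (Fin n) (Fin n) ℂ)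
    (hA : ∀ i j, A i j = -A j i) (t : Fin m) (π : Equiv.Perm (Fin n)) :
    pfaffianTerm m h A (π * Equiv.swap ⟨2 * t.1, by lia⟩ ⟨2 * t.1 + 1, by lia⟩) =
      pfaffianTerm m h A π := by
  unfold pfaffianTerm
  set ρ : Equiv.Perm (Fin n) := Equiv.swap ⟨2 * t.1, by lia⟩ ⟨2 * t.1 + 1, by lia⟩ with hρ
  rw [Equiv.Perm.sign_mul, hρ, Equiv.Perm.sign_swap (by simp), ← hρ, ← Finset.mul_prod_erase _ _
    (Finset.mem_univ t), ← Finset.mul_prod_erase Finset.univ (fun s : Fin m => A _ _)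
    (Finset.mem_univ t)]
  have h1 : ∀ s ∈ Finset.univ.erase t,
      A ((π * ρ) ⟨2 * s.1, by lia⟩) ((π * ρ) ⟨2 * s.1 + 1, by lia⟩) =
        A (π ⟨2 * s.1, by lia⟩) (π ⟨2 * s.1 + 1, by lia⟩) := by
    intro s hs
    have hne : s.1 ≠ t.1 := fun e => Finset.ne_of_mem_erase hs (Fin.ext e)
    rw [Equiv.Perm.mul_apply, Equiv.Perm.mul_apply, hρ, Equiv.swap_apply_of_ne_of_ne,
      Equiv.swap_apply_of_ne_of_ne] <;> simp only [ne_eq, Fin.mk.injEq] <;> lia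
  rw [Finset.prod_congr rfl h1, Equiv.Perm.mul_apply, Equiv.Perm.mul_apply, hρ, Equiv.swap_apply_left,
    Equiv.swap_apply_right, hA (π _) (π ⟨2 * t.1, _⟩)]
  push_cast
  ring

/-- Exchanging two whole pairs is an even permutation and only permutes the factors of the product,
so antisymmetry of `A` is not involved. -/
theorem pfaffianTerm_mul_swap_swap {n m : ℕ} (h : n = 2 * m) (A : Matrix (Fin n) (Fin n) ℂ)
    (t u : Fin m) (π : Equiv.Perm (Fin n)) :
    pfaffianTerm m h A (π * (Equiv.swap ⟨2 * t.1, by lia⟩ ⟨2 * u.1, by lia⟩ *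
      Equiv.swap ⟨2 * t.1 + 1, by lia⟩ ⟨2 * u.1 + 1, by lia⟩)) = pfaffianTerm m h A π := by
  unfold pfaffianTerm
  congr 1
  · by_cases htu : t = u
    · subst htu; simp
    · have : t.1 ≠ u.1 := fun e => htu (Fin.ext e)
      rw [Equiv.Perm.sign_mul, Equiv.Perm.sign_mul, Equiv.Perm.sign_swap, Equiv.Perm.sign_swap]
      · simp
      all_goals simp only [ne_eq, Fin.mk.injEq]; lia
  · refine Fintype.prod_equiv (Equiv.swap t u) _ _ fun s => ?_
    simp only [Equiv.Perm.mul_apply, Equiv.swap_apply_def, Fin.ext_iff]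
    split_ifs <;> lia

/-- Group the permutations by the position `π⁻¹ 0` of the value `0`. Swaps within a pair and
exchanges of pairs preserve the terms and act transitively on the `2m + 2` positions, so all groups
have the same sum. -/
theorem sum_pfaffianTerm_eq {m : ℕ} (A : Matrix (Fin (2 * m + 2)) (Fin (2 * m + 2)) ℂ)
    (hA : ∀ i j, A i j = -A j i) :
    ∑ π, pfaffianTerm (m + 1) (by lia) A π =
      (2 * m + 2) * ∑ π with π 0 = 0, pfaffianTerm (m + 1) (by lia) A π := by
  have h0 : ∀ p : Fin (2 * m + 2), ∑ π with π p = 0, pfaffianTerm (m + 1) (by lia) A π =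
      ∑ π with π 0 = 0, pfaffianTerm (m + 1) (by lia) A π := by
    have h1 := sum_pfaffianTerm_fiber_eq (by lia) A _
      (pfaffianTerm_mul_swap_pair (by lia) A hA (0 : Fin (m + 1))) 0 (Equiv.swap_apply_left _ _)
    intro p
    rcases Nat.even_or_odd' p.1 with ⟨t, ht | ht⟩
    · refine sum_pfaffianTerm_fiber_eq (by lia) A _
        (pfaffianTerm_mul_swap_swap (by lia) A (0 : Fin (m + 1)) ⟨t, by lia⟩) 0 ?_
      simp [Equiv.swap_apply_def, Fin.ext_iff, ht]
    · refine (sum_pfaffianTerm_fiber_eq (by lia) A _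
        (pfaffianTerm_mul_swap_swap (by lia) A (0 : Fin (m + 1)) ⟨t, by lia⟩) 0 ?_).trans h1
      simp [Equiv.swap_apply_def, Fin.ext_iff, ht]
  have hc : ∀ p ∈ Finset.univ, ∑ π with π p = 0, pfaffianTerm (m + 1) (by lia) A π =
      ∑ π with π 0 = 0, pfaffianTerm (m + 1) (by lia) A π := fun p _ => h0 p
  have h4 := Finset.sum_fiberwise Finset.univ
    (fun π : Equiv.Perm (Fin (2 * m + 2)) => π⁻¹ 0) (pfaffianTerm (m + 1) (by lia) A)
  rw [← h4]
  simp only [Equiv.Perm.inv_eq_iff_eq, eq_comm (a := (0 : Fin (2 * m + 2)))]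
  rw [Finset.sum_congr rfl hc]
  simp

/-- Expansion of the Pfaffian of an antisymmetric matrix along its first row. -/
theorem pfaffian_succ_succ {n : ℕ} (A : Matrix (Fin (n + 2)) (Fin (n + 2)) ℂ)
    (hA : ∀ i j, A i j = -A j i) :
    pfaffian A = ∑ j : Fin (n + 1), (-1) ^ (j : ℕ) * A 0 j.succ *
      pfaffian (A.submatrix (fun i => (j.succAbove i).succ) fun i => (j.succAbove i).succ) := by
  rcases Nat.even_or_odd' n with ⟨m, rfl | rfl⟩
  · rw [pfaffian_eq_sum_pfaffianTerm (m + 1) (by lia), sum_pfaffianTerm_eq A hA, sum_perm_fix_zero,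
      sum_perm_eq_sum_cycleRange]
    simp only [pfaffian_eq_sum_pfaffianTerm m rfl]
    -- The `2m + 2` equal groups account exactly for the change of normalisation from size `2m + 2`
    -- to size `2m`.
    have hc : (1 : ℂ) / (2 ^ (m + 1) * (m + 1).factorial) * (2 * m + 2) =
        1 / (2 ^ m * m.factorial) := by
      have : (m.factorial : ℂ) ≠ 0 := by exact_mod_cast m.factorial_ne_zero
      have : (m + 1 : ℂ) ≠ 0 := by exact_mod_cast m.succ_ne_zero
      rw [Nat.factorial_succ]
      push_cast
      field_simp
      ring
    rw [← mul_assoc, hc, Finset.mul_sum]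
    refine Finset.sum_congr rfl fun j _ => ?_
    rw [Finset.mul_sum, Finset.mul_sum, Finset.mul_sum]
    refine Finset.sum_congr rfl fun e _ => ?_
    -- The permutation fixes `0` and sends `1` to `j.succ`: its first pair gives the entry `A 0
    -- j.succ`, and the other pairs give a term of the minor.
    have key : pfaffianTerm (m + 1) (by lia) A (Equiv.Perm.decomposeFin.symm
          (0, (Fin.cycleRange j)⁻¹ * Equiv.Perm.decomposeFin.symm (0, e))) =
        (-1) ^ (j : ℕ) * A 0 j.succ * pfaffianTerm m rfl
          (A.submatrix (fun i => (j.succAbove i).succ) fun i => (j.succAbove i).succ) e := by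
      unfold pfaffianTerm
      rw [Fin.prod_univ_succ]
      have e0 : ∀ f : Equiv.Perm (Fin (2 * m + 1)),
        Equiv.Perm.decomposeFin.symm (0, f) (⟨0, by lia⟩ : Fin (2 * m + 2)) = 0 := fun f => by
          erw [Equiv.Perm.decomposeFin_symm_apply_zero]
      have e1 : ∀ (f : Equiv.Perm (Fin (2 * m + 1))) (i : ℕ) (hi : i < 2 * m + 1),
        Equiv.Perm.decomposeFin.symm (0, f) (⟨i + 1, by lia⟩ : Fin (2 * m + 2)) =
          (f ⟨i, hi⟩).succ := fun f i hi => by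
          erw [Equiv.Perm.decomposeFin_symm_apply_succ (e := f) (p := 0) ⟨i, hi⟩]; simp
      have e2 : Equiv.Perm.decomposeFin.symm (0, e) (⟨0, by lia⟩ : Fin (2 * m + 1)) = 0 := by
          erw [Equiv.Perm.decomposeFin_symm_apply_zero]
      have e3 : ∀ (i : ℕ) (hi : i < 2 * m),
        Equiv.Perm.decomposeFin.symm (0, e) (⟨i + 1, by lia⟩ : Fin (2 * m + 1)) =
          (e ⟨i, hi⟩).succ := fun i hi => by
          erw [Equiv.Perm.decomposeFin_symm_apply_succ (e := e) (p := 0) ⟨i, hi⟩]; simp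
      have hs : ((Equiv.Perm.sign (Equiv.Perm.decomposeFin.symm
          (0, (Fin.cycleRange j)⁻¹ * Equiv.Perm.decomposeFin.symm (0, e))) : ℤ) : ℂ) =
          (-1) ^ (j : ℕ) * ((Equiv.Perm.sign e : ℤ) : ℂ) := by
        simp [Fin.sign_cycleRange]
      have hP : ∀ s : Fin m, A
          (Equiv.Perm.decomposeFin.symm
            (0, (Fin.cycleRange j)⁻¹ * Equiv.Perm.decomposeFin.symm (0, e))
            ⟨2 * s.succ.1, by have := s.2; simp only [Fin.val_succ]; lia⟩)
          (Equiv.Perm.decomposeFin.symm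
            (0, (Fin.cycleRange j)⁻¹ * Equiv.Perm.decomposeFin.symm (0, e))
            ⟨2 * s.succ.1 + 1, by have := s.2; simp only [Fin.val_succ]; lia⟩) =
          A (j.succAbove (e ⟨2 * s.1, by lia⟩)).succ (j.succAbove (e ⟨2 * s.1 + 1, by lia⟩)).succ := by
        intro s
        have a1 := e1 ((Fin.cycleRange j)⁻¹ * Equiv.Perm.decomposeFin.symm (0, e)) (2 * s.1 + 1)
          (by lia)
        have a2 := e1 ((Fin.cycleRange j)⁻¹ * Equiv.Perm.decomposeFin.symm (0, e)) (2 * s.1 + 2)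
          (by lia)
        rw [Equiv.Perm.mul_apply, e3 _ (by lia), Equiv.Perm.inv_def,
          Fin.cycleRange_symm_succ] at a1 a2
        exact congrArg₂ A a1 a2
      have h0 : A
          (Equiv.Perm.decomposeFin.symm
            (0, (Fin.cycleRange j)⁻¹ * Equiv.Perm.decomposeFin.symm (0, e)) ⟨0, by lia⟩)
          (Equiv.Perm.decomposeFin.symm
            (0, (Fin.cycleRange j)⁻¹ * Equiv.Perm.decomposeFin.symm (0, e)) ⟨0 + 1, by lia⟩) =
          A 0 j.succ := by
        rw [e0, e1 _ 0 (by lia), Equiv.Perm.mul_apply, e2, Equiv.Perm.inv_def,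
          Fin.cycleRange_symm_zero]
      rw [hs, Finset.prod_congr rfl fun s _ => hP s]
      simp only [Matrix.submatrix_apply]
      refine (congrArg (fun x => _ * (x * _)) h0).trans ?_
      ring
    rw [key]
    ring
  · have h1 : ¬ Even (2 * m + 1 + 2) := by simp [Nat.even_add_one, parity_simps]
    have h2 : ¬ Even (2 * m + 1) := by simp
    simp only [pfaffian, if_neg h1, if_neg h2, mul_zero, Finset.sum_const_zero]

theorem pfaffian_congr_of_ne {n : ℕ} {A B : Matrix (Fin n) (Fin n) ℂ}
    (h : ∀ i j, i ≠ j → A i j = B i j) : pfaffian A = pfaffian B := by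
  unfold pfaffian
  split_ifs
  · congr 1
    refine Finset.sum_congr rfl fun π _ => ?_
    congr 1
    refine Finset.prod_congr rfl fun s _ => h _ _ fun e => ?_
    have := π.injective e
    simp at this
  · rfl

theorem skewOfUpper_antisymm {n : ℕ} (A : Matrix (Fin n) (Fin n) ℂ) (i j : Fin n) :
    skewOfUpper A i j = -skewOfUpper A j i := by
  simp only [skewOfUpper, Matrix.of_apply]
  split_ifs <;> first | lia | simp

/-- Strict monotonicity matters because `skewOfUpper` depends on the order of the indices. It lets
the minors in Wick's recursion be matrices of the same form. -/
theorem skewOfUpper_submatrix {m n : ℕ} (A : Matrix (Fin n) (Fin n) ℂ) {f : Fin m → Fin n}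
    (hf : StrictMono f) :
    (skewOfUpper A).submatrix f f = skewOfUpper (A.submatrix f f) := by
  ext i j
  simp only [skewOfUpper, Matrix.of_apply, Matrix.submatrix_apply, hf.lt_iff_lt]

/-! ### Wick's theorem and quadratic elements in an abstract Clifford setting -/

section Clifford

variable {𝒜 : Type*} [Ring 𝒜] [Algebra ℂ 𝒜]

/-- Moving an operator through a product of operators with which it has scalar
anticommutators. -/
theorem mul_prod_ofFn_eq {n : ℕ} (r : 𝒜) (w : Fin (n + 1) → 𝒜) (c : Fin (n + 1) → ℂ)
    (h : ∀ i, r * w i + w i * r = c i • 1) :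
    r * (List.ofFn w).prod =
      ∑ j : Fin (n + 1), ((-1) ^ (j : ℕ) * c j) • (List.ofFn fun i => w (j.succAbove i)).prod +
        ((-1 : ℂ) ^ (n + 1)) • ((List.ofFn w).prod * r) := by
  induction n with
  | zero =>
    have h0 := h 0
    simp only [List.ofFn_succ, List.ofFn_zero, List.prod_cons, List.prod_nil, mul_one]
    simp [← h0]
  | succ n ih =>
    have h0 : r * w 0 = c 0 • 1 - w 0 * r := eq_sub_of_add_eq (h 0)
    have ih' := ih (fun i => w i.succ) (fun i => c i.succ) fun i => h i.succ
    have hprod : (List.ofFn w).prod = w 0 * (List.ofFn fun i => w i.succ).prod := by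
      rw [List.ofFn_succ, List.prod_cons]
    have hrem : ∀ j : Fin (n + 1), (List.ofFn fun i => w (j.succ.succAbove i)).prod =
        w 0 * (List.ofFn fun i => w (j.succAbove i).succ).prod := fun j => by
      rw [List.ofFn_succ, List.prod_cons]
      simp only [Fin.succ_succAbove_zero, Fin.succ_succAbove_succ]
    rw [Fin.sum_univ_succ, hprod, ← mul_assoc, h0, sub_mul, smul_mul_assoc, one_mul, mul_assoc, ih']
    simp only [hrem, Fin.zero_succAbove, Fin.val_zero, Fin.val_succ, pow_zero, one_mul, mul_add,
      Finset.mul_sum, mul_smul_comm, mul_assoc, pow_succ, mul_neg, mul_one, neg_mul, neg_smul,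
      Finset.sum_neg_distrib]
    abel

/-- A vacuum state on the Clifford algebra of `W`: a normalised linear functional `ω` such that
`W` is spanned by left and right annihilators of `ω`. -/
structure IsVacuum (W : Submodule ℂ 𝒜) (ω : 𝒜 →ₗ[ℂ] ℂ) : Prop where
  anticomm : ∀ u ∈ W, ∀ v ∈ W, ∃ c : ℂ, u * v + v * u = c • 1
  map_one : ω 1 = 1
  decomp : ∀ w ∈ W, ∃ l ∈ W, ∃ r ∈ W, w = l + r ∧ (∀ X, ω (l * X) = 0) ∧ ∀ X, ω (X * r) = 0

variable {W : Submodule ℂ 𝒜} {ω : 𝒜 →ₗ[ℂ] ℂ}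

theorem IsVacuum.map_mul_prod (hω : IsVacuum W ω) {n : ℕ} {x : 𝒜} (hx : x ∈ W)
    (w : Fin (n + 1) → 𝒜) (hw : ∀ i, w i ∈ W) :
    ω (x * (List.ofFn w).prod) = ∑ j : Fin (n + 1), (-1) ^ (j : ℕ) * ω (x * w j) *
      ω (List.ofFn fun i => w (j.succAbove i)).prod := by
  obtain ⟨l, hl, r, hr, rfl, hl0, hr0⟩ := hω.decomp x hx
  choose c hc using fun i => hω.anticomm r hr (w i) (hw i)
  -- The scalar anticommutators with `r` are the two-point values: `l` contributes nothing on the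
  -- left, and `w i * r` nothing on the right.
  have hc' : ∀ i, ω ((l + r) * w i) = c i := fun i => by
    have := congrArg ω (hc i)
    rw [map_add, hr0, map_smul, hω.map_one, add_zero, smul_eq_mul, mul_one] at this
    rw [add_mul, map_add, hl0, zero_add, this]
  simp only [hc']
  rw [add_mul, map_add, hl0, zero_add, mul_prod_ofFn_eq r w c hc, map_add, map_smul, hr0,
    smul_zero, add_zero, map_sum]
  simp only [map_smul, smul_eq_mul]

theorem IsVacuum.map_eq_zero (hω : IsVacuum W ω) {x : 𝒜} (hx : x ∈ W) : ω x = 0 := by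
  obtain ⟨l, hl, r, hr, rfl, hl0, hr0⟩ := hω.decomp x hx
  have h1 := hl0 1
  have h2 := hr0 1
  rw [mul_one] at h1
  rw [one_mul] at h2
  rw [map_add, h1, h2, add_zero]

/-- Wick's theorem. -/
theorem IsVacuum.map_prod_eq_pfaffian (hω : IsVacuum W ω) (n : ℕ) (w : Fin n → 𝒜)
    (hw : ∀ i, w i ∈ W) :
    ω (List.ofFn w).prod = pfaffian (skewOfUpper (Matrix.of fun i j => ω (w i * w j))) := by
  induction n using Nat.twoStepInduction with
  | zero => simp [pfaffian, hω.map_one]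
  | one => simp [pfaffian, hω.map_eq_zero (hw 0)]
  | more n ih _ =>
    -- Both sides now satisfy the same recursion, in which two factors are removed; the terms are
    -- compared one by one.
    rw [pfaffian_succ_succ _ (skewOfUpper_antisymm _), List.ofFn_succ, List.prod_cons,
      hω.map_mul_prod (hw 0) _ fun i => hw i.succ]
    refine Finset.sum_congr rfl fun j _ => ?_
    rw [ih _ fun i => hw _, skewOfUpper_submatrix _
      (fun i k hik => Fin.succ_lt_succ_iff.mpr (Fin.strictMono_succAbove j hik))]
    simp only [skewOfUpper, Matrix.of_apply, Fin.succ_pos, if_true]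
    rfl

/-- The operators `A` through which elements of `W` can be moved. -/
def Intertwines (W : Submodule ℂ 𝒜) (A : 𝒜) : Prop := ∀ w ∈ W, ∃ w' ∈ W, w * A = A * w'

theorem Intertwines.mul {A B : 𝒜} (hA : Intertwines W A) (hB : Intertwines W B) :
    Intertwines W (A * B) := by
  intro w hw
  obtain ⟨w', hw', e⟩ := hA w hw
  obtain ⟨w'', hw'', e'⟩ := hB w' hw'
  exact ⟨w'', hw'', by rw [← mul_assoc, e, mul_assoc, e', mul_assoc]⟩

theorem Intertwines.smul_one (c : ℂ) : Intertwines W (c • (1 : 𝒜)) :=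
  fun w hw => ⟨w, hw, by simp⟩

theorem Intertwines.pow {A : 𝒜} (hA : Intertwines W A) (n : ℕ) : Intertwines W (A ^ n) := by
  induction n with
  | zero => simpa using Intertwines.smul_one (W := W) 1
  | succ n ih => rw [pow_succ]; exact ih.mul hA

/-- The identity `[w, uv] = {w, u} v - u {w, v}`, with scalar anticommutators, shows that quadratic
elements act on `W` by commutators. -/
theorem commutator_mem (hW : ∀ u ∈ W, ∀ v ∈ W, ∃ c : ℂ, u * v + v * u = c • 1) {u v w : 𝒜}
    (hu : u ∈ W) (hv : v ∈ W) (hw : w ∈ W) : w * (u * v) - (u * v) * w ∈ W := by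
  obtain ⟨c, hc⟩ := hW w hw u hu
  obtain ⟨d, hd⟩ := hW w hw v hv
  have : w * (u * v) - (u * v) * w = c • v - d • u := by
    have e1 : w * (u * v) - (u * v) * w = (w * u + u * w) * v - u * (w * v + v * w) := by
      noncomm_ring
    rw [e1, hc, hd, smul_mul_assoc, one_mul, mul_smul_comm, mul_one]
  rw [this]
  exact W.sub_mem (W.smul_mem _ hv) (W.smul_mem _ hu)

theorem one_add_smul_mul {X : 𝒜} (hX : X * X = 1) (s t : ℂ) :
    (s • 1 + t • X) * (s • 1 - t • X) = (s ^ 2 - t ^ 2) • 1 := by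
  simp only [add_mul, mul_sub, smul_mul_assoc, mul_smul_comm, one_mul, mul_one, hX]
  module

theorem one_sub_smul_mul {X : 𝒜} (hX : X * X = 1) (s t : ℂ) :
    (s • 1 - t • X) * (s • 1 + t • X) = (s ^ 2 - t ^ 2) • 1 := by
  simp only [sub_mul, mul_add, smul_mul_assoc, mul_smul_comm, one_mul, mul_one, hX]
  module

theorem isUnit_smul_one_add_smul {X : 𝒜} (hX : X * X = 1) {s t : ℂ} (hst : s ^ 2 - t ^ 2 ≠ 0) :
    IsUnit (s • 1 + t • X) := by
  refine ⟨⟨s • 1 + t • X, (s ^ 2 - t ^ 2)⁻¹ • (s • 1 - t • X), ?_, ?_⟩, rfl⟩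
  · rw [mul_smul_comm, one_add_smul_mul hX, smul_smul, inv_mul_cancel₀ hst, one_smul]
  · rw [smul_mul_assoc, one_sub_smul_mul hX, smul_smul, inv_mul_cancel₀ hst, one_smul]

/-- With `c = [w, X]` and `X² = 1`, one has `(s - tX) w (s + tX) = (s² - t²) w + st c - t² X c`, and
`s - tX` is proportional to the inverse of `s + tX`. It remains to see that `c` and `X c` lie in
`W`. -/
theorem intertwines_smul_one_add_smul
    (hW : ∀ u ∈ W, ∀ v ∈ W, ∃ c : ℂ, u * v + v * u = c • 1) {X u v : 𝒜} {d : ℂ}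
    (hu : u ∈ W) (hv : v ∈ W) (hXuv : X = d • (u * v))
    (hX : X * X = 1) {s t : ℂ} (hst : s ^ 2 - t ^ 2 ≠ 0) :
    Intertwines W (s • 1 + t • X) := by
  have hc : ∀ w ∈ W, w * X - X * w ∈ W := fun w hw => by
    rw [hXuv, mul_smul_comm, smul_mul_assoc, ← smul_sub]
    exact W.smul_mem _ (commutator_mem hW hu hv hw)
  intro w hw
  have h1 := hc w hw
  have h2 := hc _ h1
  set c := w * X - X * w with hcdef
  -- Since `X² = 1`, the commutator `c` anticommutes with `X`; thus `X c` is a multiple of the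
  -- double commutator, which is in `W`.
  have e1 : c * X - X * c = (-2 : ℂ) • (X * c) := by
    have : c * X = - (X * c) := by
      rw [hcdef, sub_mul, mul_sub, mul_assoc, hX, ← mul_assoc X X, hX]
      noncomm_ring
    rw [this]; module
  have h3 : X * c ∈ W := by
    have := W.smul_mem (-1 / 2 : ℂ) h2
    rw [e1, smul_smul] at this
    norm_num at this
    exact this
  refine ⟨(s ^ 2 - t ^ 2)⁻¹ • ((s ^ 2 - t ^ 2) • w + (s * t) • c - (t ^ 2) • (X * c)),
    W.smul_mem _ (W.sub_mem (W.add_mem (W.smul_mem _ hw) (W.smul_mem _ h1)) (W.smul_mem _ h3)), ?_⟩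
  have e2 : (s ^ 2 - t ^ 2) • w + (s * t) • c - (t ^ 2) • (X * c) =
      (s • 1 - t • X) * (w * (s • 1 + t • X)) := by
    have e3 : X * (X * w) = w := by rw [← mul_assoc, hX, one_mul]
    rw [hcdef]
    simp only [sub_mul, mul_sub, mul_add, smul_mul_assoc, mul_smul_comm, one_mul, mul_one, e3]
    module
  rw [e2, mul_smul_comm, ← mul_assoc, one_add_smul_mul hX, smul_mul_assoc, one_mul, smul_smul,
    inv_mul_cancel₀ hst, one_smul]

end Clifford

variable {a b : ℤ}

/-! ### Anticommutation relations of the generators `p_k`, `q_k` -/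

section Generators

theorem spin_mul_self (u : ℤˣ) : spin u * spin u = 1 := by
  rcases Int.units_eq_one_or u with rfl | rfl <;> simp [spin]

theorem spin_neg (u : ℤˣ) : spin (-u) = -spin u := by
  rcases Int.units_eq_one_or u with rfl | rfl <;> simp [spin]

theorem flipLeft_flipLeft (k : DualSite a b) (σ : Config a b) : flipLeft k (flipLeft k σ) = σ := by
  funext x
  simp only [flipLeft]
  split_ifs <;> simp

theorem flipLeft_comm (k l : DualSite a b) (σ : Config a b) :
    flipLeft k (flipLeft l σ) = flipLeft l (flipLeft k σ) := by
  funext x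
  simp only [flipLeft]
  split_ifs <;> rfl

/-- The operator `e_σ ↦ f σ • e_τ`, with `τ = flipLeft k σ`. -/
def flipOp (k : DualSite a b) (f : Config a b → ℂ) : Op a b :=
  Matrix.of fun τ σ => if τ = flipLeft k σ then f σ else 0

theorem opP_eq_flipOp (k : DualSite a b) : opP k = flipOp k fun σ => (spin (σ k.right) : ℂ) := rfl

theorem opQ_eq_flipOp (k : DualSite a b) :
    opQ k = flipOp k fun σ => Complex.I * (spin (σ k.left) : ℂ) := rfl

theorem flipOp_mul_flipOp_apply (k l : DualSite a b) (f g : Config a b → ℂ) (τ σ : Config a b) :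
    (flipOp k f * flipOp l g) τ σ =
      if τ = flipLeft k (flipLeft l σ) then f (flipLeft l σ) * g σ else 0 := by
  simp [flipOp, Matrix.mul_apply]

theorem flipOp_mul_flipOp_self (k : DualSite a b) (f g : Config a b → ℂ) :
    flipOp k f * flipOp k g = Matrix.diagonal fun σ => f (flipLeft k σ) * g σ := by
  ext τ σ
  rw [flipOp_mul_flipOp_apply, flipLeft_flipLeft, Matrix.diagonal_apply]
  split_ifs with h
  · rw [h]
  · rfl

/-- The flips commute, so both products send `e_σ` to the same basis vector and only the
coefficients need comparing. For `k = l` that vector is `e_σ` itself, which is why a nonzero `c` is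
allowed there. -/
theorem flipOp_anticomm (k l : DualSite a b) (f g : Config a b → ℂ) (c : ℂ) (hc : k ≠ l → c = 0)
    (h : ∀ σ, f (flipLeft l σ) * g σ + g (flipLeft k σ) * f σ = c) :
    flipOp k f * flipOp l g + flipOp l g * flipOp k f = c • 1 := by
  ext τ σ
  rw [Matrix.add_apply, flipOp_mul_flipOp_apply, flipOp_mul_flipOp_apply, flipLeft_comm l k,
    Matrix.smul_apply, Matrix.one_apply]
  by_cases hkl : k = l
  · subst hkl
    rw [flipLeft_flipLeft]
    split_ifs
    · rw [h, smul_eq_mul, mul_one]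
    · simp
  · rw [hc hkl, zero_smul]
    split_ifs
    · rw [h, hc hkl]
    · simp

theorem dualSite_trichotomy (k l : DualSite a b) : k.1 < l.1 ∨ k = l ∨ l.1 < k.1 := by
  rcases lt_trichotomy k.1 l.1 with h | h | h
  · exact Or.inl h
  · exact Or.inr (Or.inl (Subtype.ext h))
  · exact Or.inr (Or.inr h)

theorem flipLeft_right (k l : DualSite a b) (σ : Config a b) :
    flipLeft l σ k.right = if k.1 < l.1 then -σ k.right else σ k.right := by
  simp only [flipLeft, DualSite.right, Int.add_one_le_iff]

theorem flipLeft_left (k l : DualSite a b) (σ : Config a b) :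
    flipLeft l σ k.left = if k.1 ≤ l.1 then -σ k.left else σ k.left := rfl

/-- For `k ≠ l`, exactly one of the two flips reverses the spin read by the other operator, so the
products have opposite signs. For a `p` and a `q` this happens even when `k = l`, since the flip at
`k` reverses the left spin but not the right one. -/
theorem opP_anticomm_opP (k l : DualSite a b) :
    opP k * opP l + opP l * opP k = (if k = l then 2 else 0 : ℂ) • 1 := by
  rw [opP_eq_flipOp, opP_eq_flipOp]
  refine flipOp_anticomm _ _ _ _ _ (fun h => if_neg h) fun σ => ?_
  simp only [flipLeft_right]
  rcases dualSite_trichotomy k l with h | rfl | h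
  · have : k ≠ l := fun e => h.ne (by rw [e])
    simp only [h, if_true, this, if_false, h.not_gt, spin_neg]; push_cast; ring
  · simp only [lt_irrefl, if_false, if_true]
    norm_cast
    rw [spin_mul_self]; norm_num
  · have : k ≠ l := fun e => h.ne (by rw [e])
    simp only [h, if_true, this, if_false, h.not_gt, spin_neg]; push_cast; ring

theorem opQ_anticomm_opQ (k l : DualSite a b) :
    opQ k * opQ l + opQ l * opQ k = (if k = l then 2 else 0 : ℂ) • 1 := by
  rw [opQ_eq_flipOp, opQ_eq_flipOp]
  refine flipOp_anticomm _ _ _ _ _ (fun h => if_neg h) fun σ => ?_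
  simp only [flipLeft_left]
  rcases dualSite_trichotomy k l with h | rfl | h
  · have : k ≠ l := fun e => h.ne (by rw [e])
    simp only [h.le, if_true, this, if_false, h.not_ge, spin_neg]; push_cast; ring
  · have := congrArg (fun x : ℝ => (x : ℂ)) (spin_mul_self (σ k.left))
    push_cast at this
    simp only [le_refl, if_true, spin_neg]
    push_cast
    linear_combination (-2 * Complex.I ^ 2) * this - 2 * Complex.I_sq
  · have : k ≠ l := fun e => h.ne (by rw [e])
    simp only [h.le, if_true, this, if_false, h.not_ge, spin_neg]; push_cast; ring

theorem opP_anticomm_opQ (k l : DualSite a b) : opP k * opQ l + opQ l * opP k = 0 := by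
  rw [opP_eq_flipOp, opQ_eq_flipOp, ← zero_smul ℂ 1]
  refine flipOp_anticomm _ _ _ _ _ (fun h => rfl) fun σ => ?_
  simp only [flipLeft_left, flipLeft_right]
  by_cases h : k.1 < l.1
  · simp only [h, if_true, h.not_ge, if_false, spin_neg]; push_cast; ring
  · simp only [h, if_false, not_lt.mp h, if_true, spin_neg]; push_cast; ring

variable (a b) in
/-- The space spanned by the Clifford generators. -/
def cliffordSpace : Submodule ℂ (Op a b) :=
  Submodule.span ℂ (Set.range (Sum.elim opP opQ : DualSite a b ⊕ DualSite a b → Op a b))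

theorem opP_mem (k : DualSite a b) : opP k ∈ cliffordSpace a b :=
  Submodule.subset_span ⟨Sum.inl k, rfl⟩

theorem opQ_mem (k : DualSite a b) : opQ k ∈ cliffordSpace a b :=
  Submodule.subset_span ⟨Sum.inr k, rfl⟩

theorem anticomm_of_mem_cliffordSpace :
    ∀ u ∈ cliffordSpace a b, ∀ v ∈ cliffordSpace a b, ∃ c : ℂ, u * v + v * u = c • 1 := by
  intro u hu v hv
  induction hu, hv using Submodule.span_induction₂ with
  | mem_mem x y hx hy =>
    obtain ⟨k | k, rfl⟩ := hx <;> obtain ⟨l | l, rfl⟩ := hy <;> simp only [Sum.elim_inl, Sum.elim_inr]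
    · exact ⟨_, opP_anticomm_opP k l⟩
    · exact ⟨0, by rw [opP_anticomm_opQ, zero_smul]⟩
    · exact ⟨0, by rw [add_comm, opP_anticomm_opQ, zero_smul]⟩
    · exact ⟨_, opQ_anticomm_opQ k l⟩
  | zero_left y hy => exact ⟨0, by simp⟩
  | zero_right x hx => exact ⟨0, by simp⟩
  | add_left x y z _ _ _ h₁ h₂ =>
    obtain ⟨c, hc⟩ := h₁
    obtain ⟨d, hd⟩ := h₂
    exact ⟨c + d, by rw [add_smul, ← hc, ← hd]; noncomm_ring⟩
  | add_right x y z _ _ _ h₁ h₂ =>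
    obtain ⟨c, hc⟩ := h₁
    obtain ⟨d, hd⟩ := h₂
    exact ⟨c + d, by rw [add_smul, ← hc, ← hd]; noncomm_ring⟩
  | smul_left r x y _ _ h =>
    obtain ⟨c, hc⟩ := h
    exact ⟨r * c, by rw [mul_smul, ← hc, smul_mul_assoc, mul_smul_comm, smul_add]⟩
  | smul_right r x y _ _ h =>
    obtain ⟨c, hc⟩ := h
    exact ⟨r * c, by rw [mul_smul, ← hc, smul_mul_assoc, mul_smul_comm, smul_add]⟩

end Generators

/-! ### The transfer matrix as a product of exponentials of quadratic elements -/

section Transfer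

/-- The operator `e_σ ↦ σ_{k-1/2} σ_{k+1/2} e_σ`. -/
def bondOp (k : DualSite a b) : Op a b :=
  Matrix.diagonal fun σ => ((spin (σ k.left) * spin (σ k.right) : ℝ) : ℂ)

theorem bondOp_eq (k : DualSite a b) : bondOp k = (-Complex.I) • (opP k * opQ k) := by
  rw [opP_eq_flipOp, opQ_eq_flipOp, flipOp_mul_flipOp_self, ← Matrix.diagonal_smul, bondOp]
  congr 1
  funext σ
  simp only [flipLeft_right, lt_irrefl, if_false, Pi.smul_apply, smul_eq_mul]
  push_cast
  linear_combination ((spin (σ k.left) : ℂ) * (spin (σ k.right) : ℂ)) * Complex.I_sq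

theorem bondOp_mul_self (k : DualSite a b) : bondOp k * bondOp k = 1 := by
  rw [bondOp, Matrix.diagonal_mul_diagonal, ← Matrix.diagonal_one]
  congr 1
  funext σ
  rw [← Complex.ofReal_mul, mul_mul_mul_comm, spin_mul_self, spin_mul_self]
  norm_num

/-- The bond takes only the values `±1`, and `exp (t x) = cosh t + x sinh t` for `x = ±1`. -/
theorem diagonal_exp_bond (k : DualSite a b) (t : ℝ) :
    (Matrix.diagonal fun σ : Config a b =>
      ((Real.exp (t * (spin (σ k.left) * spin (σ k.right))) : ℝ) : ℂ)) =
      ((Real.cosh t : ℝ) : ℂ) • 1 + ((Real.sinh t : ℝ) : ℂ) • bondOp k := by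
  rw [bondOp, ← Matrix.diagonal_one, ← Matrix.diagonal_smul, ← Matrix.diagonal_smul,
    Matrix.diagonal_add]
  congr 1
  funext σ
  simp only [Pi.smul_apply, smul_eq_mul, mul_one]
  norm_cast
  rcases Int.units_eq_one_or (σ k.left) with h | h <;>
    rcases Int.units_eq_one_or (σ k.right) with h' | h' <;>
    simp [h, h', spin, Real.cosh_add_sinh, ← sub_eq_add_neg, Real.cosh_sub_sinh]

theorem intertwines_diagonal_exp_bond (t : ℝ) (S : Finset (DualSite a b)) :
    Intertwines (cliffordSpace a b) (Matrix.diagonal fun σ : Config a b =>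
      ((Real.exp (t * ∑ k ∈ S, spin (σ k.left) * spin (σ k.right)) : ℝ) : ℂ)) := by
  induction S using Finset.induction_on with
  | empty => simpa using Intertwines.smul_one (W := cliffordSpace a b) 1
  | insert k S hk ih =>
    simp only [Finset.sum_insert hk, mul_add, Real.exp_add, Complex.ofReal_mul]
    rw [← Matrix.diagonal_mul_diagonal, diagonal_exp_bond]
    refine (intertwines_smul_one_add_smul anticomm_of_mem_cliffordSpace (opP_mem k) (opQ_mem k)
      (bondOp_eq k) (bondOp_mul_self k) ?_).mul ih
    norm_cast
    rw [Real.cosh_sq_sub_sinh_sq]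
    exact one_ne_zero

theorem intertwines_transferHSqrt (β : ℝ) :
    Intertwines (cliffordSpace a b) (transferHSqrt a b β) :=
  intertwines_diagonal_exp_bond (β / 2) Finset.univ

theorem isUnit_transferHSqrt (β : ℝ) : IsUnit (transferHSqrt a b β) := by
  rw [transferHSqrt, Matrix.isUnit_diagonal, Pi.isUnit_iff]
  exact fun σ => (Complex.ofReal_ne_zero.mpr (Real.exp_pos _).ne').isUnit

/-- The configuration obtained from `σ` by flipping the spin at `x`. -/
def flipAt (x : Site a b) (σ : Config a b) : Config a b := Function.update σ x (-σ x)

theorem flipAt_flipAt (x : Site a b) (σ : Config a b) : flipAt x (flipAt x σ) = σ := by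
  simp [flipAt]

/-- The operator `e_σ ↦ e_τ`, with `τ = flipAt x σ`. -/
def flipAtOp (x : Site a b) : Op a b :=
  Matrix.of fun τ σ => if flipAt x τ = σ then 1 else 0

theorem flipAtOp_mul_apply (x : Site a b) (M : Op a b) (τ σ : Config a b) :
    (flipAtOp x * M) τ σ = M (flipAt x τ) σ := by
  simp [flipAtOp, Matrix.mul_apply]

theorem flipAtOp_mul_self (x : Site a b) : flipAtOp x * flipAtOp x = 1 := by
  ext τ σ
  rw [flipAtOp_mul_apply, flipAtOp, Matrix.of_apply, flipAt_flipAt, Matrix.one_apply]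

/-- The flips to the left of two neighbouring dual sites cancel everywhere except at the site
between them. Both coefficients read the spin at that site, so they multiply to a constant. -/
theorem flipAtOp_eq (k l : DualSite a b) (h : k.1 + 1 = l.1) :
    flipAtOp l.left = Complex.I • (opP k * opQ l) := by
  ext τ σ
  have hx : k.right = l.left := Subtype.ext h
  have hf : flipLeft k (flipLeft l σ) = flipAt l.left σ := by
    funext y
    by_cases hy : y = l.left
    · subst hy
      simp [flipLeft, flipAt, DualSite.left, show ¬ l.1 ≤ k.1 by lia]
    · have hy' : y.1 ≠ l.1 := fun e => hy (Subtype.ext e)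
      rw [flipAt, Function.update_of_ne hy]
      simp only [flipLeft]
      split_ifs <;> first | lia | simp
  have hiff : flipAt l.left τ = σ ↔ τ = flipAt l.left σ :=
    ⟨fun e => by rw [← e, flipAt_flipAt], fun e => by rw [e, flipAt_flipAt]⟩
  rw [Matrix.smul_apply, opP_eq_flipOp, opQ_eq_flipOp, flipOp_mul_flipOp_apply, hf, hx,
    flipAtOp, Matrix.of_apply]
  simp only [hiff, flipLeft_left, le_refl, if_true, spin_neg]
  split_ifs
  · have := congrArg (fun x : ℝ => (x : ℂ)) (spin_mul_self (σ l.left))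
    push_cast at this ⊢
    rw [smul_eq_mul]
    linear_combination (Complex.I ^ 2) * this + Complex.I_sq
  · simp

/-- The vertical interactions, with the spins off `S` kept fixed. -/
def verticalOp (β : ℝ) (S : Finset (Site a b)) : Op a b :=
  Matrix.of fun σ ρ => if ∀ i, i ∉ S → σ i = ρ i then
    ((Real.exp (β * ∑ i : Site a b, spin (σ i) * spin (ρ i)) : ℝ) : ℂ) else 0

theorem verticalOp_empty (β : ℝ) : ∃ c : ℂ, c ≠ 0 ∧ verticalOp (a := a) (b := b) β ∅ = c • 1 := by
  refine ⟨((Real.exp (β * ∑ i : Site a b, 1) : ℝ) : ℂ),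
    Complex.ofReal_ne_zero.mpr (Real.exp_pos _).ne', ?_⟩
  ext σ ρ
  have h : (∀ i, i ∉ (∅ : Finset (Site a b)) → σ i = ρ i) ↔ σ = ρ := by simp [funext_iff]
  simp only [verticalOp, Matrix.of_apply, h, Matrix.smul_apply, Matrix.one_apply]
  split_ifs with h
  · subst h
    simp only [spin_mul_self, smul_eq_mul, mul_one]
  · simp

/-- Releasing the spin at `x` allows it to disagree with the row below, at the cost of replacing the
weight `e^β` by `e^{-β}`; hence the factor `1 + e^{-2β} F`, with `F` the flip at `x`. -/
theorem verticalOp_insert (β : ℝ) {S : Finset (Site a b)} {x : Site a b} (hx : x ∉ S) :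
    verticalOp β (insert x S) =
      ((1 : ℂ) • 1 + ((Real.exp (-2 * β) : ℝ) : ℂ) • flipAtOp x) * verticalOp β S := by
  ext σ ρ
  rw [one_smul, add_mul, one_mul, smul_mul_assoc, Matrix.add_apply, Matrix.smul_apply,
    flipAtOp_mul_apply]
  simp only [verticalOp, Matrix.of_apply]
  by_cases h : ∀ i, i ∉ insert x S → σ i = ρ i
  · rw [if_pos h]
    have hne : ∀ i, i ≠ x → flipAt x σ i = σ i := fun i hi => Function.update_of_ne hi _ _
    by_cases hσ : σ x = ρ x
    · have h1 : ∀ i, i ∉ S → σ i = ρ i := fun i hi => by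
        by_cases e : i = x
        · rw [e, hσ]
        · exact h i (by simp [e, hi])
      have h2 : ¬ ∀ i, i ∉ S → flipAt x σ i = ρ i := fun h2 => by
        have := h2 x hx
        simp only [flipAt, Function.update_self] at this
        rw [hσ] at this
        rcases Int.units_eq_one_or (ρ x) with e | e <;> simp [e] at this
      rw [if_pos h1, if_neg h2, smul_zero, add_zero]
    · have hσ' : -σ x = ρ x := by
        rcases Int.units_eq_one_or (σ x) with e | e <;>
          rcases Int.units_eq_one_or (ρ x) with e' | e' <;> simp_all
      have h1 : ¬ ∀ i, i ∉ S → σ i = ρ i := fun h1 => hσ (h1 x hx)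
      have h2 : ∀ i, i ∉ S → flipAt x σ i = ρ i := fun i hi => by
        by_cases e : i = x
        · rw [e, flipAt, Function.update_self, hσ']
        · rw [hne i e]
          exact h i (by simp [e, hi])
      rw [if_neg h1, if_pos h2, zero_add, smul_eq_mul, ← Complex.ofReal_mul, ← Real.exp_add]
      congr 2
      -- Here `ρ x = -σ x`, so flipping `σ` at `x` changes that summand from `-1` to `1`.
      have e1 : ∑ i, spin (flipAt x σ i) * spin (ρ i) = ∑ i, spin (σ i) * spin (ρ i) + 2 := by
        rw [← Finset.add_sum_erase _ _ (Finset.mem_univ x),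
          ← Finset.add_sum_erase Finset.univ (fun i => spin (σ i) * spin (ρ i)) (Finset.mem_univ x),
          Finset.sum_congr rfl fun i hi => by rw [hne i (Finset.ne_of_mem_erase hi)],
          flipAt, Function.update_self, ← hσ', spin_neg]
        linear_combination 2 * spin_mul_self (σ x)
      rw [e1]
      ring
  · rw [if_neg h]
    have h1 : ¬ ∀ i, i ∉ S → σ i = ρ i := fun h1 => h fun i hi => h1 i (by simp_all)
    have h2 : ¬ ∀ i, i ∉ S → flipAt x σ i = ρ i := fun h2 => h fun i hi => by
      rw [Finset.mem_insert, not_or] at hi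
      rw [← h2 i hi.2, flipAt, Function.update_of_ne hi.1]
    rw [if_neg h1, if_neg h2, smul_zero, add_zero]

theorem transferV_eq (β : ℝ) :
    transferV a b β = verticalOp β (Finset.univ.filter fun x => a < x.1 ∧ x.1 < b) := by
  ext σ ρ
  simp only [transferV, verticalOp, Matrix.of_apply]
  congr 1
  refine propext (forall_congr' fun i => imp_congr_left ?_)
  have := i.2.1
  have := i.2.2
  simp only [Finset.mem_filter_univ]
  lia

theorem verticalOp_spec {β : ℝ} (hβ : 0 < β) (S : Finset (Site a b))
    (hS : ∀ x ∈ S, a < x.1 ∧ x.1 < b) :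
    IsUnit (verticalOp β S) ∧ Intertwines (cliffordSpace a b) (verticalOp β S) := by
  induction S using Finset.induction_on with
  | empty =>
    obtain ⟨c, hc, e⟩ := verticalOp_empty (a := a) (b := b) β
    rw [e]
    exact ⟨isUnit_one.smul (Units.mk0 c hc), Intertwines.smul_one c⟩
  | insert x S hx ih =>
    obtain ⟨h1, h2⟩ := ih fun y hy => hS y (Finset.mem_insert_of_mem hy)
    obtain ⟨hxa, hxb⟩ := hS x (Finset.mem_insert_self x S)
    -- Positivity of `β` enters here: at `β = 0` the factor `1 + F` would be singular.
    have hst : (1 : ℂ) ^ 2 - ((Real.exp (-2 * β) : ℝ) : ℂ) ^ 2 ≠ 0 := by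
      have h3 : Real.exp (-2 * β) < 1 := Real.exp_lt_one_iff.mpr (by linarith)
      have h4 := Real.exp_pos (-2 * β)
      have h5 : (1 : ℝ) ^ 2 - Real.exp (-2 * β) ^ 2 ≠ 0 := by nlinarith
      exact_mod_cast h5
    rw [verticalOp_insert β hx]
    exact ⟨(isUnit_smul_one_add_smul (flipAtOp_mul_self x) hst).mul h1,
      (intertwines_smul_one_add_smul anticomm_of_mem_cliffordSpace
        (opP_mem ⟨x.1 - 1, by lia, by lia⟩) (opQ_mem ⟨x.1, hxa.le, hxb⟩)
        (flipAtOp_eq ⟨x.1 - 1, by lia, by lia⟩ ⟨x.1, hxa.le, hxb⟩ (by simp))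
        (flipAtOp_mul_self x) hst).mul h2⟩

theorem isUnit_transfer {β : ℝ} (hβ : 0 < β) : IsUnit (transfer a b β) := by
  refine ((isUnit_transferHSqrt β).mul ?_).mul (isUnit_transferHSqrt β)
  rw [transferV_eq]
  exact (verticalOp_spec hβ _ (by simp)).1

theorem intertwines_transfer {β : ℝ} (hβ : 0 < β) :
    Intertwines (cliffordSpace a b) (transfer a b β) := by
  refine ((intertwines_transferHSqrt β).mul ?_).mul (intertwines_transferHSqrt β)
  rw [transferV_eq]
  exact (verticalOp_spec hβ _ (by simp)).2

end Transfer

/-! ### Nonvanishing of the normalisation `⟨e₊|V^N|e₊⟩` -/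

section Positivity

open scoped ComplexOrder

theorem transfer_apply (β : ℝ) (σ ρ : Config a b) : ∃ r : ℝ, 0 ≤ r ∧ (σ = ρ → 0 < r) ∧
    transfer a b β σ ρ = r := by
  rw [transfer, transferHSqrt, Matrix.mul_diagonal, Matrix.diagonal_mul, transferV, Matrix.of_apply]
  split_ifs with h
  · exact ⟨_, (mul_pos (mul_pos (Real.exp_pos _) (Real.exp_pos _)) (Real.exp_pos _)).le,
      fun _ => mul_pos (mul_pos (Real.exp_pos _) (Real.exp_pos _)) (Real.exp_pos _),
      by rw [Complex.ofReal_mul, Complex.ofReal_mul]⟩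
  · exact ⟨0, le_rfl, fun e => (h fun i _ => by rw [e]).elim, by simp⟩

theorem transfer_nonneg (β : ℝ) (σ ρ : Config a b) : 0 ≤ transfer a b β σ ρ := by
  obtain ⟨r, hr, _, e⟩ := transfer_apply β σ ρ
  rw [e]
  exact_mod_cast hr

theorem transfer_self_pos (β : ℝ) (σ : Config a b) : 0 < transfer a b β σ σ := by
  obtain ⟨r, _, hr, e⟩ := transfer_apply β σ σ
  rw [e]
  exact_mod_cast hr rfl

theorem transfer_pow_nonneg (β : ℝ) (N : ℕ) (σ ρ : Config a b) :
    0 ≤ (transfer a b β ^ N) σ ρ := by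
  induction N generalizing ρ with
  | zero =>
    rw [pow_zero, Matrix.one_apply]
    split_ifs <;> simp
  | succ N ih =>
    rw [pow_succ, Matrix.mul_apply]
    exact Finset.sum_nonneg fun τ _ => mul_nonneg (ih τ) (transfer_nonneg β τ ρ)

theorem transfer_pow_self_pos (β : ℝ) (N : ℕ) (σ : Config a b) :
    0 < (transfer a b β ^ N) σ σ := by
  induction N with
  | zero => simp
  | succ N ih =>
    rw [pow_succ, Matrix.mul_apply]
    exact Finset.sum_pos' (fun τ _ => mul_nonneg (transfer_pow_nonneg β N σ τ)
      (transfer_nonneg β τ σ)) ⟨σ, Finset.mem_univ σ, mul_pos ih (transfer_self_pos β σ)⟩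

theorem transfer_pow_self_ne_zero (β : ℝ) (N : ℕ) (σ : Config a b) :
    (transfer a b β ^ N) σ σ ≠ 0 :=
  (transfer_pow_self_pos β N σ).ne'

end Positivity

/-! ### The vacuum state and its annihilators -/

section Vacuum

/-- The functional `X ↦ ⟨e₊| V^N X |e₊⟩ / ⟨e₊| V^N |e₊⟩`. -/
def vacuumState (a b : ℤ) (N : ℕ) (β : ℝ) : Op a b →ₗ[ℂ] ℂ where
  toFun X := (transfer a b β ^ N * X) 1 1 / (transfer a b β ^ N) 1 1
  map_add' X Y := by rw [mul_add, Matrix.add_apply, add_div]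
  map_smul' c X := by
    rw [mul_smul_comm, Matrix.smul_apply, smul_eq_mul, smul_eq_mul, mul_div_assoc, RingHom.id_apply]

theorem vacuumState_apply (N : ℕ) (β : ℝ) (X : Op a b) : vacuumState a b N β X =
    (transfer a b β ^ N * X) 1 1 / (transfer a b β ^ N) 1 1 := rfl

theorem correlation_eq_vacuumState (N : ℕ) (β : ℝ) (L : List (Op a b)) :
    correlation N β L = vacuumState a b N β L.prod := by
  have h : plusVec a b = Pi.single 1 1 := rfl
  rw [correlation, vacuumState_apply, h, Matrix.mulVec_single_one, Matrix.mulVec_single_one,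
    single_one_dotProduct, single_one_dotProduct]
  rfl

theorem vacuumState_one (N : ℕ) (β : ℝ) : vacuumState a b N β 1 = 1 := by
  rw [vacuumState_apply, mul_one, div_self (transfer_pow_self_ne_zero β N 1)]

/-- The generator `q_k - i p_k`, which annihilates `e₊`. -/
def rightAnnihilator (k : DualSite a b) : Op a b := opQ k - Complex.I • opP k

/-- The generator `q_k + i p_k`, which is annihilated by `e₊ᵀ`. -/
def leftAnnihilator (k : DualSite a b) : Op a b := opQ k + Complex.I • opP k

theorem rightAnnihilator_mem (k : DualSite a b) : rightAnnihilator k ∈ cliffordSpace a b :=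
  Submodule.sub_mem _ (opQ_mem k) (Submodule.smul_mem _ _ (opP_mem k))

theorem leftAnnihilator_mem (k : DualSite a b) : leftAnnihilator k ∈ cliffordSpace a b :=
  Submodule.add_mem _ (opQ_mem k) (Submodule.smul_mem _ _ (opP_mem k))

theorem rightAnnihilator_apply_one (k : DualSite a b) (τ : Config a b) :
    rightAnnihilator k τ 1 = 0 := by
  simp [rightAnnihilator, opQ, opP]

/-- The only `σ` mapped to `(+)` has spin `-1` just left of `k` and `+1` just right of it, so the
contributions of `q_k` and `i p_k` are `-i` and `i`. -/
theorem leftAnnihilator_one_apply (k : DualSite a b) (σ : Config a b) :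
    leftAnnihilator k 1 σ = 0 := by
  simp only [leftAnnihilator, opQ, opP, Matrix.add_apply, Matrix.smul_apply, Matrix.of_apply]
  split_ifs with h
  · have e : σ = flipLeft k 1 := by rw [h, flipLeft_flipLeft]
    rw [e, flipLeft_right, flipLeft_left]
    simp [spin_neg]
  · simp

theorem mul_rightAnnihilator_apply (X : Op a b) (k : DualSite a b) :
    (X * rightAnnihilator k) 1 1 = 0 := by
  simp [Matrix.mul_apply, rightAnnihilator_apply_one]

theorem leftAnnihilator_mul_apply (X : Op a b) (k : DualSite a b) :
    (leftAnnihilator k * X) 1 1 = 0 := by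
  simp [Matrix.mul_apply, leftAnnihilator_one_apply]

theorem rightAnnihilator_anticomm_leftAnnihilator (k l : DualSite a b) :
    rightAnnihilator k * leftAnnihilator l + leftAnnihilator l * rightAnnihilator k =
      (if k = l then 4 else 0 : ℂ) • 1 := by
  have h1 := opQ_anticomm_opQ k l
  have h2 := opP_anticomm_opP k l
  have h3 := opP_anticomm_opQ k l
  have h4 := opP_anticomm_opQ l k
  have e : rightAnnihilator k * leftAnnihilator l + leftAnnihilator l * rightAnnihilator k =
      (opQ k * opQ l + opQ l * opQ k) - (Complex.I * Complex.I) • (opP k * opP l + opP l * opP k) -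
        Complex.I • (opP k * opQ l + opQ l * opP k) +
        Complex.I • (opP l * opQ k + opQ k * opP l) := by
    simp only [rightAnnihilator, leftAnnihilator, add_mul, mul_add, sub_mul, mul_sub,
      smul_mul_assoc, mul_smul_comm, mul_smul]
    module
  rw [e, h1, h2, h3, h4, Complex.I_mul_I]
  split_ifs
  · module
  · module

theorem Intertwines.inv_mul_mul_mem {W : Submodule ℂ (Op a b)} {A w : Op a b}
    (hA : Intertwines W A) (hu : IsUnit A) (hw : w ∈ W) : A⁻¹ * w * A ∈ W := by
  obtain ⟨w', hw', e⟩ := hA w hw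
  rwa [mul_assoc, e, Matrix.nonsing_inv_mul_cancel_left _ _
    ((Matrix.isUnit_iff_isUnit_det A).mp hu)]

variable (a b) in
/-- The generators of the annihilators of the vacuum `X ↦ ⟨e₊| V^N X |e₊⟩`: right annihilators,
then left annihilators. -/
def annihilator (N : ℕ) (β : ℝ) : DualSite a b ⊕ DualSite a b → Op a b :=
  Sum.elim rightAnnihilator fun k =>
    (transfer a b β ^ N)⁻¹ * leftAnnihilator k * transfer a b β ^ N

theorem annihilator_mem (N : ℕ) {β : ℝ} (hβ : 0 < β) (i : DualSite a b ⊕ DualSite a b) :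
    annihilator a b N β i ∈ cliffordSpace a b := by
  rcases i with k | k
  · exact rightAnnihilator_mem k
  · exact ((intertwines_transfer hβ).pow N).inv_mul_mul_mem ((isUnit_transfer hβ).pow N)
      (leftAnnihilator_mem k)

theorem vacuumState_mul_annihilator_inl (N : ℕ) (β : ℝ) (X : Op a b) (k : DualSite a b) :
    vacuumState a b N β (X * annihilator a b N β (Sum.inl k)) = 0 := by
  rw [vacuumState_apply, annihilator, Sum.elim_inl, ← mul_assoc, mul_rightAnnihilator_apply,
    zero_div]

theorem vacuumState_annihilator_inr_mul (N : ℕ) {β : ℝ} (hβ : 0 < β) (X : Op a b)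
    (k : DualSite a b) : vacuumState a b N β (annihilator a b N β (Sum.inr k) * X) = 0 := by
  have hu := (Matrix.isUnit_iff_isUnit_det _).mp ((isUnit_transfer (a := a) (b := b) hβ).pow N)
  rw [vacuumState_apply, annihilator, Sum.elim_inr, mul_assoc, mul_assoc,
    Matrix.mul_nonsing_inv_cancel_left _ _ hu, leftAnnihilator_mul_apply, zero_div]

/-- Write a relation as `x + y = 0`, with `x` a right and `y` a left annihilator of `ω`. Pairing
with the unconjugated `leftAnnihilator l` isolates the coefficients of `x` through the
anticommutator, and `ω 1 = 1` makes them visible. The coefficients of `y` follow after undoing the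
conjugation. -/
theorem linearIndependent_annihilator (N : ℕ) {β : ℝ} (hβ : 0 < β) :
    LinearIndependent ℂ (annihilator a b N β) := by
  rw [Fintype.linearIndependent_iff]
  intro g hg
  have hu := (Matrix.isUnit_iff_isUnit_det _).mp ((isUnit_transfer (a := a) (b := b) hβ).pow N)
  rw [Fintype.sum_sum_type] at hg
  set ω := vacuumState a b N β with hω
  set x := ∑ k, g (Sum.inl k) • annihilator a b N β (Sum.inl k) with hx
  set y := ∑ k, g (Sum.inr k) • annihilator a b N β (Sum.inr k) with hy
  have hXx : ∀ X, ω (X * x) = 0 := fun X => by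
    simp [hx, Finset.mul_sum, hω, vacuumState_mul_annihilator_inl]
  have hyX : ∀ X, ω (y * X) = 0 := fun X => by
    simp [hy, Finset.sum_mul, hω, vacuumState_annihilator_inr_mul N hβ]
  have h1 : ∀ l, g (Sum.inl l) = 0 := fun l => by
    have e : x * leftAnnihilator l + leftAnnihilator l * x = (4 * g (Sum.inl l)) • 1 := by
      simp only [hx, annihilator, Sum.elim_inl, Finset.sum_mul, Finset.mul_sum, smul_mul_assoc,
        mul_smul_comm]
      simp only [← Finset.sum_add_distrib, ← smul_add, rightAnnihilator_anticomm_leftAnnihilator]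
      simp [mul_comm, smul_smul]
    -- On the left, `x = -y` turns the first product into one starting with `y`, and the second ends
    -- with `x`; `ω` kills both.
    have e' := congrArg ω e
    rw [map_add, hXx, eq_neg_of_add_eq_zero_left hg, neg_mul, map_neg, hyX, map_smul, hω,
      vacuumState_one] at e'
    simpa using e'.symm
  have hy0 : y = 0 := by
    rw [← hg, hx]
    simp [h1]
  have hz : ∑ k, g (Sum.inr k) • leftAnnihilator k = 0 := by
    have e : transfer a b β ^ N * y = (∑ k, g (Sum.inr k) • leftAnnihilator k) *
        transfer a b β ^ N := by
      simp only [hy, annihilator, Sum.elim_inr, Finset.mul_sum, Finset.sum_mul, mul_smul_comm,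
        smul_mul_assoc, mul_assoc, Matrix.mul_nonsing_inv_cancel_left _ _ hu]
    rw [hy0, mul_zero] at e
    rw [← Matrix.mul_nonsing_inv_cancel_right (transfer a b β ^ N)
      (∑ k, g (Sum.inr k) • leftAnnihilator k) hu, ← e, zero_mul]
  rintro (l | l)
  · exact h1 l
  · have e : rightAnnihilator l * (∑ k, g (Sum.inr k) • leftAnnihilator k) +
        (∑ k, g (Sum.inr k) • leftAnnihilator k) * rightAnnihilator l =
          (4 * g (Sum.inr l)) • 1 := by
      simp only [Finset.sum_mul, Finset.mul_sum, smul_mul_assoc, mul_smul_comm]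
      simp only [← Finset.sum_add_distrib, ← smul_add, rightAnnihilator_anticomm_leftAnnihilator]
      simp [mul_comm, smul_smul]
    have e' := congrArg ω e
    rw [hz, mul_zero, zero_mul, add_zero, map_zero, map_smul, hω, vacuumState_one] at e'
    simpa using e'.symm

/-- The independent annihilators lie in `W` and are as many as the generators spanning it. -/
theorem span_annihilator (N : ℕ) {β : ℝ} (hβ : 0 < β) :
    Submodule.span ℂ (Set.range (annihilator a b N β)) = cliffordSpace a b := by
  refine Submodule.eq_of_le_of_finrank_le ?_ ?_
  · rw [Submodule.span_le]
    rintro _ ⟨i, rfl⟩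
    exact annihilator_mem N hβ i
  · rw [finrank_span_eq_card (linearIndependent_annihilator N hβ)]
    exact finrank_range_le_card _

theorem isVacuum_vacuumState (N : ℕ) {β : ℝ} (hβ : 0 < β) :
    IsVacuum (cliffordSpace a b) (vacuumState a b N β) where
  anticomm := anticomm_of_mem_cliffordSpace
  map_one := vacuumState_one N β
  decomp w hw := by
    rw [← span_annihilator N hβ, Submodule.mem_span_range_iff_exists_fun] at hw
    obtain ⟨c, rfl⟩ := hw
    refine ⟨∑ k, c (Sum.inr k) • annihilator a b N β (Sum.inr k),
      Submodule.sum_mem _ fun k _ => Submodule.smul_mem _ _ (annihilator_mem N hβ _),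
      ∑ k, c (Sum.inl k) • annihilator a b N β (Sum.inl k),
      Submodule.sum_mem _ fun k _ => Submodule.smul_mem _ _ (annihilator_mem N hβ _),
      by rw [Fintype.sum_sum_type, add_comm], fun X => ?_, fun X => ?_⟩
    · simp [Finset.sum_mul, vacuumState_annihilator_inr_mul N hβ]
    · simp [Finset.mul_sum, vacuumState_mul_annihilator_inl]

end Vacuum

/-! ### The fermion operators lie in the Clifford space; conclusion -/

section Fermion

theorem baseFermion_mem (k : DualSite a b) (s : Species) : baseFermion k s ∈ cliffordSpace a b := by
  cases s
  · exact Submodule.smul_mem _ _ (Submodule.add_mem _ (opP_mem k) (opQ_mem k))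
  · exact Submodule.smul_mem _ _ (Submodule.sub_mem _ (opP_mem k) (opQ_mem k))

theorem fermionHorizontal_mem {β : ℝ} (hβ : 0 < β) (k : DualSite a b) (y : ℕ) (s : Species) :
    fermionHorizontal β k y s ∈ cliffordSpace a b := by
  rw [fermionHorizontal, Matrix.inv_pow']
  exact ((intertwines_transfer hβ).pow y).inv_mul_mul_mem ((isUnit_transfer hβ).pow y)
    (baseFermion_mem k s)

theorem southEast_mem {β : ℝ} (hβ : 0 < β) (k : DualSite a b) (y : ℕ) :
    southEast β k y ∈ cliffordSpace a b :=
  Submodule.add_mem _ (fermionHorizontal_mem hβ k y _)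
    (Submodule.smul_mem _ _ (fermionHorizontal_mem hβ k y _))

theorem southWest_mem {β : ℝ} (hβ : 0 < β) (k : DualSite a b) (y : ℕ) :
    southWest β k y ∈ cliffordSpace a b :=
  Submodule.add_mem _ (fermionHorizontal_mem hβ k y _)
    (Submodule.smul_mem _ _ (fermionHorizontal_mem hβ k y _))

theorem fermionVertical_mem {β : ℝ} (hβ : 0 < β) (x : Site a b) (y : ℕ) (s : Species) :
    fermionVertical β x y s ∈ cliffordSpace a b := by
  have hE := fun k => southEast_mem (a := a) (b := b) hβ k y
  have hW := fun k => southWest_mem (a := a) (b := b) hβ k y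
  have hs : ∀ (c : ℂ) {M : Op a b}, M ∈ cliffordSpace a b → c • M ∈ cliffordSpace a b :=
    fun c _ h => Submodule.smul_mem _ c h
  unfold fermionVertical
  split_ifs
  · cases s
    · exact hs _ (Submodule.sub_mem _ (hs _ (hE _)) (hs _ (hW _)))
    · exact hs _ (Submodule.sub_mem _ (hs _ (hW _)) (hs _ (hE _)))
  · cases s
    · exact hs _ (hs _ (hE _))
    · exact hs _ (hE _)
  · cases s
    · exact Submodule.neg_mem _ (hs _ (hs _ (hW _)))
    · exact hs _ (hW _)
  -- This branch occurs only for a row with a single site, `a = b`.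
  · exact Submodule.zero_mem _

theorem fermion_mem {N : ℕ} {β : ℝ} (hβ : 0 < β) (z : Edge a b N) (s : Species) :
    fermion β z s ∈ cliffordSpace a b := by
  cases z with
  | horizontal k y => exact fermionHorizontal_mem hβ k y s
  | vertical x y => exact fermionVertical_mem hβ x y s

theorem multiPoint_eq_pfaffian {N n : ℕ} {β : ℝ} (hβ : 0 < β) (s : Fin n → Species)
    (z : Fin n → Edge a b N) :
    multiPoint β s z = pfaffian (skewOfUpper (twoPointMatrix β s z)) := by
  rw [multiPoint, correlation_eq_vacuumState,
    (isVacuum_vacuumState N hβ).map_prod_eq_pfaffian n _ fun i => fermion_mem hβ (z i) (s i)]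
  congr 2
  ext i j
  simp [twoPointMatrix, correlation_eq_vacuumState]

/-- Diagonal entries never occur in a Pfaffian, so antisymmetry off the diagonal is enough. -/
theorem pfaffian_skewOfUpper {n : ℕ} (A : Matrix (Fin n) (Fin n) ℂ)
    (h : ∀ i j, i ≠ j → A i j = -A j i) : pfaffian (skewOfUpper A) = pfaffian A := by
  refine pfaffian_congr_of_ne fun i j hij => ?_
  simp only [skewOfUpper, Matrix.of_apply]
  split_ifs with h1 h2
  · rfl
  · rw [h i j hij]
  · exact (hij (le_antisymm (not_lt.mp h2) (not_lt.mp h1))).elim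

end Fermion

end IsingFermion

end

theorem mainTheorem6 (a b : ℤ) (hab : a < b) (N : ℕ) (β : ℝ) (hβ : 0 < β) (n : ℕ)
    (s : Fin n → IsingFermion.Species) (z : Fin n → IsingFermion.Edge a b N) :
    IsingFermion.multiPoint β s z =
        IsingFermion.pfaffian (IsingFermion.skewOfUpper (IsingFermion.twoPointMatrix β s z)) ∧
      ((∀ i j, i ≠ j → IsingFermion.twoPointMatrix β s z i j =
          -IsingFermion.twoPointMatrix β s z j i) →
        IsingFermion.multiPoint β s z =
          IsingFermion.pfaffian (IsingFermion.twoPointMatrix β s z)) :=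
  ⟨IsingFermion.multiPoint_eq_pfaffian hβ s z, fun h => by
    rw [IsingFermion.multiPoint_eq_pfaffian hβ s z, IsingFermion.pfaffian_skewOfUpper _ h]⟩
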